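/- **Setting.** Let $\mathfrak C=\{0,1\}^{\mathbb N}$. For finite words $a,b$ on $\{0,1\}$ let $(a,b)$ denote the rectangle $\{a\zeta\}\times\{b\zeta\}\subset\mathfrak C^2$, identified with the dyadic rectangle of $[0,1]^2$ of side lengths $2^{-|a|}$ (horizontal) and $2^{-|b|}$ (vertical); its *size* is $\|(a,b)\|=-\log_2 2^{-|a|}-\log_2 2^{-|b|}=|a|+|b|$. A vertical subdivision replaces $(a,b)$ by $(a0,b),(a1,b)$, a horizontal one by $(a,b0),(a,b1)$. A *pattern* is a finite set of rectangles obtained from $\{[0,1]^2\}$ by finitely many such subdivisions; its *fineness* is the largest size of its rectangles. A pair of numbered patterns (domain and target) with the same number of rectangles represents the homeomorphism $g$ of $\mathfrak C^2$ with $g(a_i\zeta_1,b_i\zeta_2)=(a_i'\zeta_1,b_i'\zeta_2)$, where $(a_i,b_i)$ and $(a'_i,b'_i)$ are the $i$-th domain and target rectangles. The group $2V$ consists of all homeomorphisms so obtained, acting on the right. A *grid pattern* is a pattern obtained by subdividing along segments of length one (whole strips $I\times[0,1]$ or $[0,1]\times J$ at a time). A *grid diagram* is a pair of numbered patterns whose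 target is a grid pattern. A *vertical (horizontal) global subdivision* subdivides vertically (horizontally) all target rectangles of one strip $I\times[0,1]$ (resp. $[0,1]\times J$) together with the corresponding domain rectangles. A grid diagram is *reduced* if it is not the result of a global subdivision of a grid diagram. The *fineness* of $g\in 2V$ is the fineness of the target pattern of the reduced grid diagram of $g$. Let $R=(r_1,r_2)$ be a rectangle of the target pattern of a pair representing $g$. $R$ is *essential* (for $g$) if neither of the following holds: 1. $r_1=w_1x$ with $x\in\{0,1\}$ and, with $y\ne x$ the other letter, there are words $w_1',w_2'$ such that $g^{-1}(R)=(w_1'x,w_2')$ and $g^{-1}(w_1y\zeta_1,r_2\zeta_2)=(w_1'y\zeta_1,w_2'\zeta_2)$ for all $\zeta_1,\zeta_2\in\mathfrak C$; 2. $r_2=w_2x$ with $x\in\{0,1\}$ and, with $y\ne x$ the other letter, there are words $w_1',w_2'$ such that $g^{-1}(R)=(w_1',w_2'x)$ and $g^{-1}(r_1\zeta_1,w_2y\zeta_2)=(w_1'\zeta_1,w_2'y\zeta_2)$ for all $\zeta_1,\zeta_2\in\mathfrak C$. Let $X_{2V}$ be the set of the following 26 elements; $\varepsilon$ is the empty word,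 and a list of $(a,b)\mapsto(a',b')$ means $(a\zeta_1,b\zeta_2)\mapsto(a'\zeta_1,b'\zeta_2)$. - Let $x_0$ be $(00,\varepsilon)\mapsto(0,\varepsilon)$, $(01,\varepsilon)\mapsto(10,\varepsilon)$, $(1,\varepsilon)\mapsto(11,\varepsilon)$. Let $x_1,x_2,\hat x_1$ be the elements acting as $x_0$ on the first coordinate after the prefix $1$, $11$, $0$ respectively, $\hat x_2$ the one acting as $x_0$ after the prefix $01$, each being the identity elsewhere. Let $y_0,y_1,\hat y_1$ be $x_0,x_1,\hat x_1$ with the two coordinates interchanged. For $j=1,2$ let ${}_hx_j$ (resp. $\hat{{}_hx_j}$) act as $x_{j-1}$ on the first coordinate of $\mathfrak C\times 1\mathfrak C$ (resp. $\mathfrak C\times 0\mathfrak C$) and be the identity elsewhere. - $B_0$: $(0,0)\mapsto(0,\varepsilon)$, $(0,1)\mapsto(10,\varepsilon)$, $(1,\varepsilon)\mapsto(11,\varepsilon)$. $B_1$: $(0,\varepsilon)\mapsto(0,\varepsilon)$, $(10,0)\mapsto(10,\varepsilon)$, $(10,1)\mapsto(110,\varepsilon)$, $(11,\varepsilon)\mapsto(111,\varepsilon)$.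 - $C_0$: $(\varepsilon,0)\mapsto(0,\varepsilon)$, $(\varepsilon,1)\mapsto(1,\varepsilon)$. $C_1$: $(0,\varepsilon)\mapsto(0,\varepsilon)$, $(1,0)\mapsto(10,\varepsilon)$, $(1,1)\mapsto(11,\varepsilon)$. - $\pi_0$ exchanges the prefixes $0,10$ of the first coordinate, $\pi_1$ exchanges $10,110$, $\overline{\pi_0}$ exchanges $0,1$, and $\overline{\pi_1}$ exchanges $10,11$; each is the identity elsewhere. - $\alpha_0$: $(0,0)\mapsto(00,\varepsilon)$, $(0,1)\mapsto(01,\varepsilon)$, $(1,\varepsilon)\mapsto(1,\varepsilon)$. $\alpha_1$: $(0,00)\mapsto(000,\varepsilon)$, $(0,01)\mapsto(001,\varepsilon)$, $(0,1)\mapsto(01,\varepsilon)$, $(1,\varepsilon)\mapsto(1,\varepsilon)$. $\beta_0,\beta_1$ are $\alpha_0,\alpha_1$ with the two coordinates interchanged (in domain and target). - $\hat B_0$: $(0,\varepsilon)\mapsto(00,\varepsilon)$, $(1,0)\mapsto(01,\varepsilon)$, $(1,1)\mapsto(1,\varepsilon)$. $\gamma_0$ is $\hat B_0$ with the two coordinates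 interchanged. For a set $X\subset 2V$ let $|g|_X$ be the word length of $g$ with respect to $X\cup X^{-1}$ ($\infty$ if $g$ is not in the subgroup generated by $X$). **Statement.** Let $X=X_{2V}$ or, more generally, let $X$ be any subset of $2V$ each of whose elements is represented by a pair of numbered patterns in which all domain and target rectangles have size at most $4$. Let $g\in 2V$. 1. If $g$ has fineness $k$, then $|g|_X\ge k/8$. 2. If a pair of numbered patterns represents $g$ and $R$ is an essential rectangle of its target pattern, then $|g|_X\ge\|R\|/8$. -/

import Mathlib

namespace TwoV

/-! ### The Cantor square and dyadic rectangles -/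

/-- The Cantor set `{0,1} × {0,1} × ⋯`, with the product topology. -/
abbrev Cantor : Type := ℕ → Fin 2

/-- Finite words on `{0,1}`. -/
abbrev Word : Type := List (Fin 2)

/-- The concatenation `wζ` of a finite word and an infinite word. -/
def prepend : Word → Cantor → Cantor
  | [], ζ => ζ
  | x :: w, ζ => fun n => match n with
    | 0 => x
    | n + 1 => prepend w ζ n

/-- A dyadic rectangle, coded by the pair of words `(w, w')`: it stands for the subset
`{wζ} × {w'ζ}` of the Cantor square, and for the rectangle of the unit square whose horizontal
(resp. vertical) side is the standard dyadic interval with address `w` (resp. `w'`). -/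
abbrev Rect : Type := Word × Word

/-- The point `(wζ₁, w'ζ₂)` of the rectangle `(w, w')`. -/
def Rect.pt (R : Rect) (z : Cantor × Cantor) : Cantor × Cantor :=
  (prepend R.1 z.1, prepend R.2 z.2)

/-- The subset `{wζ} × {w'ζ}` of the Cantor square. -/
def Rect.toSet (R : Rect) : Set (Cantor × Cantor) := Set.range R.pt

/-- The horizontal side length of the rectangle in the unit square. -/
noncomputable def Rect.width (R : Rect) : ℝ := (1 / 2 : ℝ) ^ R.1.length

/-- The vertical side length of the rectangle in the unit square. -/
noncomputable def Rect.height (R : Rect) : ℝ := (1 / 2 : ℝ) ^ R.2.length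

/-- The size `‖R‖`; see `Rect.size_eq` for the formula with logarithms of side lengths. -/
def Rect.size (R : Rect) : ℕ := R.1.length + R.2.length

theorem Rect.size_eq (R : Rect) :
    (R.size : ℝ) = -(Real.logb 2 R.width + Real.logb 2 R.height) := by
  have h : Real.logb 2 (1 / 2 : ℝ) = -1 := by
    rw [one_div, Real.logb_inv, Real.logb_self_eq_one (by norm_num)]
  simp only [Rect.width, Rect.height, Rect.size, Real.logb_pow, h]
  push_cast
  ring

/-- The left (`x = 0`) or right (`x = 1`) half produced by a vertical subdivision. -/
def Rect.vhalf (R : Rect) (x : Fin 2) : Rect := (R.1 ++ [x], R.2)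

/-- The bottom (`x = 0`) or top (`x = 1`) half produced by a horizontal subdivision. -/
def Rect.hhalf (R : Rect) (x : Fin 2) : Rect := (R.1, R.2 ++ [x])

/-! ### Patterns and pairs of numbered patterns -/

/-- Patterns: obtained from the trivial pattern by finitely many vertical and horizontal
subdivisions of rectangles. -/
inductive IsPattern : Finset Rect → Prop
  | trivial : IsPattern {([], [])}
  | vert {P : Finset Rect} {R : Rect} (hP : IsPattern P) (hR : R ∈ P) :
      IsPattern (P.erase R ∪ {R.vhalf 0, R.vhalf 1})
  | horiz {P : Finset Rect} {R : Rect} (hP : IsPattern P) (hR : R ∈ P) :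
      IsPattern (P.erase R ∪ {R.hhalf 0, R.hhalf 1})

/-- The fineness `‖P‖` of a pattern: the largest size of its rectangles. -/
def fineness (P : Finset Rect) : ℕ := P.sup Rect.size

/-- A pair of numbered patterns with the same number of rectangles, up to simultaneous
renumbering: the finite set of pairs (rectangle number `i` of the domain pattern,
rectangle number `i` of the target pattern). -/
structure PatternPair where
  cells : Finset (Rect × Rect)
  dom_inj : Set.InjOn Prod.fst (cells : Set (Rect × Rect))
  tgt_inj : Set.InjOn Prod.snd (cells : Set (Rect × Rect))
  dom_isPattern : IsPattern (cells.image Prod.fst)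
  tgt_isPattern : IsPattern (cells.image Prod.snd)

/-- The domain pattern. -/
def PatternPair.dom (p : PatternPair) : Finset Rect := p.cells.image Prod.fst

/-- The target pattern. -/
def PatternPair.tgt (p : PatternPair) : Finset Rect := p.cells.image Prod.snd

/-- Homeomorphisms of the Cantor square. -/
abbrev Homeo : Type := (Cantor × Cantor) ≃ₜ (Cantor × Cantor)

/-- `g` sends `(aζ₁, bζ₂)` to `(a'ζ₁, b'ζ₂)`. -/
def MapsRect (g : Homeo) (R R' : Rect) : Prop := ∀ z, g (R.pt z) = R'.pt z

/-- The pair of numbered patterns `p` represents `g`. -/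
def PatternPair.Represents (p : PatternPair) (g : Homeo) : Prop :=
  ∀ c ∈ p.cells, MapsRect g c.1 c.2

/-- The group `2V`: all homeomorphisms obtained from pairs of numbered patterns. -/
def twoV : Set Homeo := {g | ∃ p : PatternPair, p.Represents g}

/-! ### Grid diagrams -/

/-- Subdivide vertically all the rectangles of the strip `I × [0,1]`, where `I` has address `a`. -/
def vsubStrip (a : Word) (G : Finset Rect) : Finset Rect :=
  G.biUnion fun R => if R.1 = a then {R.vhalf 0, R.vhalf 1} else {R}

/-- Subdivide horizontally all the rectangles of the strip `[0,1] × J`, where `J` has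
address `b`. -/
def hsubStrip (b : Word) (G : Finset Rect) : Finset Rect :=
  G.biUnion fun R => if R.2 = b then {R.hhalf 0, R.hhalf 1} else {R}

/-- Grid patterns: obtained by subdividing the unit square along line segments of length one. -/
inductive IsGridPattern : Finset Rect → Prop
  | trivial : IsGridPattern {([], [])}
  | vert {G : Finset Rect} {R : Rect} (hG : IsGridPattern G) (hR : R ∈ G) :
      IsGridPattern (vsubStrip R.1 G)
  | horiz {G : Finset Rect} {R : Rect} (hG : IsGridPattern G) (hR : R ∈ G) :
      IsGridPattern (hsubStrip R.2 G)

/-- A grid diagram is a pair of numbered patterns whose target pattern is a grid pattern. -/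
def PatternPair.IsGridDiagram (p : PatternPair) : Prop := IsGridPattern p.tgt

/-- `q` is obtained from `p` by a vertical global subdivision: all the target rectangles of a
vertical strip `I × [0,1]`, and the corresponding domain rectangles, are subdivided vertically. -/
def PatternPair.VertGlobalSub (p q : PatternPair) : Prop :=
  ∃ R ∈ p.tgt, q.cells = p.cells.biUnion fun c =>
    if c.2.1 = R.1 then {(c.1.vhalf 0, c.2.vhalf 0), (c.1.vhalf 1, c.2.vhalf 1)} else {c}

/-- `q` is obtained from `p` by a horizontal global subdivision. -/
def PatternPair.HorizGlobalSub (p q : PatternPair) : Prop :=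
  ∃ R ∈ p.tgt, q.cells = p.cells.biUnion fun c =>
    if c.2.2 = R.2 then {(c.1.hhalf 0, c.2.hhalf 0), (c.1.hhalf 1, c.2.hhalf 1)} else {c}

/-- Reduced grid diagrams: no inverse of a vertical or horizontal global subdivision applies. -/
def PatternPair.IsReducedGridDiagram (q : PatternPair) : Prop :=
  q.IsGridDiagram ∧
    (¬ ∃ p : PatternPair, p.IsGridDiagram ∧ p.VertGlobalSub q) ∧
    (¬ ∃ p : PatternPair, p.IsGridDiagram ∧ p.HorizGlobalSub q)

/-- `k` is the fineness of `g`: the fineness of the target pattern of the reduced grid diagram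
of `g`. -/
def HasFineness (g : Homeo) (k : ℕ) : Prop :=
  ∃ q : PatternPair, q.IsReducedGridDiagram ∧ q.Represents g ∧ fineness q.tgt = k

/-! ### Essential rectangles -/

/-- A vertical reduction merges `R = (w₁x, w₂)` with the congruent rectangle `(w₁y, w₂)` on the
other side of its vertical edge, `y ≠ x`. -/
def VertReducible (g : Homeo) (R : Rect) : Prop :=
  ∃ (w₁ w₁' w₂' : Word) (x y : Fin 2), y ≠ x ∧ R.1 = w₁ ++ [x] ∧
    g.symm '' R.toSet = Rect.toSet (w₁' ++ [x], w₂') ∧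
    ∀ z, g.symm (Rect.pt (w₁ ++ [y], R.2) z) = Rect.pt (w₁' ++ [y], w₂') z

/-- A horizontal reduction merges `R = (w₁, w₂x)` with the congruent rectangle `(w₁, w₂y)`,
`y ≠ x`. -/
def HorizReducible (g : Homeo) (R : Rect) : Prop :=
  ∃ (w₂ w₁' w₂' : Word) (x y : Fin 2), y ≠ x ∧ R.2 = w₂ ++ [x] ∧
    g.symm '' R.toSet = Rect.toSet (w₁', w₂' ++ [x]) ∧
    ∀ z, g.symm (Rect.pt (R.1, w₂ ++ [y]) z) = Rect.pt (w₁', w₂' ++ [y]) z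

/-- The rectangle `R` of a target pattern of `g` is essential. -/
def IsEssential (g : Homeo) (R : Rect) : Prop := ¬ VertReducible g R ∧ ¬ HorizReducible g R

/-! ### The generators and the word length -/

/-- The tables of the elements of `X_{2V}`: each generator sends, for every entry
`(a, b) ↦ (a', b')` of its table, the point `(aζ₁, bζ₂)` to `(a'ζ₁, b'ζ₂)`. -/
def generatorTables : List (List (Rect × Rect)) :=
  [ -- `x₀`, `x₁`, `x₂`
    [(([0, 0], []), ([0], [])), (([0, 1], []), ([1, 0], [])), (([1], []), ([1, 1], []))],
    [(([0], []), ([0], [])), (([1, 0, 0], []), ([1, 0], [])),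
      (([1, 0, 1], []), ([1, 1, 0], [])), (([1, 1], []), ([1, 1, 1], []))],
    [(([0], []), ([0], [])), (([1, 0], []), ([1, 0], [])),
      (([1, 1, 0, 0], []), ([1, 1, 0], [])), (([1, 1, 0, 1], []), ([1, 1, 1, 0], [])),
      (([1, 1, 1], []), ([1, 1, 1, 1], []))],
    -- `y₀`, `y₁`
    [(([], [0, 0]), ([], [0])), (([], [0, 1]), ([], [1, 0])), (([], [1]), ([], [1, 1]))],
    [(([], [0]), ([], [0])), (([], [1, 0, 0]), ([], [1, 0])),
      (([], [1, 0, 1]), ([], [1, 1, 0])), (([], [1, 1]), ([], [1, 1, 1]))],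
    -- `B₀`, `B₁`
    [(([0], [0]), ([0], [])), (([0], [1]), ([1, 0], [])), (([1], []), ([1, 1], []))],
    [(([0], []), ([0], [])), (([1, 0], [0]), ([1, 0], [])),
      (([1, 0], [1]), ([1, 1, 0], [])), (([1, 1], []), ([1, 1, 1], []))],
    -- `C₀`, `C₁`
    [(([], [0]), ([0], [])), (([], [1]), ([1], []))],
    [(([0], []), ([0], [])), (([1], [0]), ([1, 0], [])), (([1], [1]), ([1, 1], []))],
    -- `x₁` hat, `x₂` hat, `y₁` hat
    [(([0, 0, 0], []), ([0, 0], [])), (([0, 0, 1], []), ([0, 1, 0], [])),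
      (([0, 1], []), ([0, 1, 1], [])), (([1], []), ([1], []))],
    [(([0, 0], []), ([0, 0], [])), (([0, 1, 0, 0], []), ([0, 1, 0], [])),
      (([0, 1, 0, 1], []), ([0, 1, 1, 0], [])), (([0, 1, 1], []), ([0, 1, 1, 1], [])),
      (([1], []), ([1], []))],
    [(([], [0, 0, 0]), ([], [0, 0])), (([], [0, 0, 1]), ([], [0, 1, 0])),
      (([], [0, 1]), ([], [0, 1, 1])), (([], [1]), ([], [1]))],
    -- `π₀`, `π₁`
    [(([0], []), ([1, 0], [])), (([1, 0], []), ([0], [])), (([1, 1], []), ([1, 1], []))],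
    [(([0], []), ([0], [])), (([1, 0], []), ([1, 1, 0], [])),
      (([1, 1, 0], []), ([1, 0], [])), (([1, 1, 1], []), ([1, 1, 1], []))],
    -- `π₀` bar, `π₁` bar
    [(([0], []), ([1], [])), (([1], []), ([0], []))],
    [(([0], []), ([0], [])), (([1, 0], []), ([1, 1], [])), (([1, 1], []), ([1, 0], []))],
    -- `α₀`, `α₁`
    [(([0], [0]), ([0, 0], [])), (([0], [1]), ([0, 1], [])), (([1], []), ([1], []))],
    [(([0], [0, 0]), ([0, 0, 0], [])), (([0], [0, 1]), ([0, 0, 1], [])),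
      (([0], [1]), ([0, 1], [])), (([1], []), ([1], []))],
    -- `β₀`, `β₁`
    [(([0], [0]), ([], [0, 0])), (([1], [0]), ([], [0, 1])), (([], [1]), ([], [1]))],
    [(([0, 0], [0]), ([], [0, 0, 0])), (([0, 1], [0]), ([], [0, 0, 1])),
      (([1], [0]), ([], [0, 1])), (([], [1]), ([], [1]))],
    -- `B₀` hat, `γ₀`
    [(([0], []), ([0, 0], [])), (([1], [0]), ([0, 1], [])), (([1], [1]), ([1], []))],
    [(([], [0]), ([], [0, 0])), (([0], [1]), ([], [0, 1])), (([1], [1]), ([], [1]))],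
    -- `ₕx₁`, `ₕx₂`
    [(([0, 0], [1]), ([0], [1])), (([0, 1], [1]), ([1, 0], [1])),
      (([1], [1]), ([1, 1], [1])), (([], [0]), ([], [0]))],
    [(([0], [1]), ([0], [1])), (([1, 0, 0], [1]), ([1, 0], [1])),
      (([1, 0, 1], [1]), ([1, 1, 0], [1])), (([1, 1], [1]), ([1, 1, 1], [1])),
      (([], [0]), ([], [0]))],
    -- `ₕx₁` hat, `ₕx₂` hat
    [(([0, 0], [0]), ([0], [0])), (([0, 1], [0]), ([1, 0], [0])),
      (([1], [0]), ([1, 1], [0])), (([], [1]), ([], [1]))],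
    [(([0], [0]), ([0], [0])), (([1, 0, 0], [0]), ([1, 0], [0])),
      (([1, 0, 1], [0]), ([1, 1, 0], [0])), (([1, 1], [0]), ([1, 1, 1], [0])),
      (([], [1]), ([], [1]))] ]

/-- The generating set `X_{2V}`. -/
def X2V : Set Homeo := {g | ∃ t ∈ generatorTables, ∀ c ∈ t, MapsRect g c.1 c.2}

/-- The elements of `2V` that are represented by a pair of numbered patterns all of whose domain
and target rectangles have size at most `d` (equivalently, by a pair of colored binary trees, both
of depth at most `d`). -/
def depthAtMost (d : ℕ) : Set Homeo :=
  {g | ∃ p : PatternPair, p.Represents g ∧ fineness p.dom ≤ d ∧ fineness p.tgt ≤ d}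

/-- The element `s₁ s₂ ⋯ sₙ` of a word, for the right action: `s₁` is applied first. -/
def evalWord (l : List Homeo) : Homeo :=
  l.foldr (fun s h => s.trans h) (Homeomorph.refl (Cantor × Cantor))

/-- The word length of `g` with respect to `X`: the least length of a word in the elements of `X`
and their inverses that represents `g` (`⊤` if there is none). -/
noncomputable def wordLength (X : Set Homeo) (g : Homeo) : ℕ∞ :=
  ⨅ l ∈ {l : List Homeo | (∀ s ∈ l, s ∈ X ∨ s.symm ∈ X) ∧ evalWord l = g}, (l.length : ℕ∞)

end TwoV

namespace TwoV

/-! ### Cylinders of the Cantor set -/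

/-! The proof measures `g` by `LocallyFine g n`: the square is covered by rectangles `R'`, both of
whose words have length at most `n`, over which `g` is a prefix replacement `R → R'`. This quantity
is subadditive under composition (`LocallyFine.trans`). Every generator and every inverse of one is
locally fine with `n = 4`, so a word of length `ℓ` is locally fine with `n = 4ℓ`.

Local fineness makes long target rectangles reducible. If `g` maps `D` onto `R` by prefixes and the
first word of `R` is `wx` with `|w| ≥ n`, then each horizontal line of the cylinder over `w` through
`R` lies in a single rectangle `R'`. Hence `g` is a prefix replacement across the edge between `R`
and its sibling (`LocallyFine.exists_sibling`). So both words of an essential rectangle have length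
at most `n`, its size is at most `2n = 8ℓ`, and this is the second bound.

For the fineness, the target of a grid diagram is a product `A × B` of complete prefix codes. If `A`
has a word longer than `n`, a longest word of `A` has its sibling in `A`, and the sibling lemma
applies in every row. The whole strip can then be merged, so the diagram is not reduced
(`LocallyFine.exists_vertGlobalSub`). The merged cells must again form patterns. This is clear for
tilings, and in dimension two every tiling by dyadic rectangles is a pattern
(`isPattern_iff_isTiling`).

Horizontal statements follow from vertical ones by exchanging the two coordinates. -/

theorem prepend_append (u v : Word) (ζ : Cantor) :
    prepend (u ++ v) ζ = prepend u (prepend v ζ) := by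
  induction u with
  | nil => rfl
  | cons x u ih => simp only [List.cons_append, prepend, ih]

theorem prepend_cons_inj {x y : Fin 2} {u v : Word} {ζ η : Cantor} :
    prepend (x :: u) ζ = prepend (y :: v) η ↔ x = y ∧ prepend u ζ = prepend v η := by
  constructor
  · intro h
    exact ⟨congrFun h 0, funext fun n => congrFun h (n + 1)⟩
  · rintro ⟨rfl, h⟩
    simp only [prepend, h]

theorem prepend_injective (w : Word) : Function.Injective (prepend w) := by
  induction w with
  | nil => exact fun _ _ h => h
  | cons x w ih => exact fun ζ η h => ih (prepend_cons_inj.1 h).2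

theorem exists_append_of_prepend_eq {u v : Word} {ζ η : Cantor}
    (h : prepend u ζ = prepend v η) (hl : u.length ≤ v.length) :
    ∃ t, v = u ++ t ∧ ζ = prepend t η := by
  induction u generalizing v with
  | nil => exact ⟨v, rfl, h⟩
  | cons x u ih =>
    cases v with
    | nil => simp at hl
    | cons y v =>
      obtain ⟨rfl, h'⟩ := prepend_cons_inj.1 h
      obtain ⟨t, rfl, ht⟩ := ih h' (by simpa using hl)
      exact ⟨t, rfl, ht⟩

theorem eq_of_prepend_eq_of_length_eq {u v : Word} {ζ η : Cantor}
    (h : prepend u ζ = prepend v η) (hl : u.length = v.length) : u = v := by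
  obtain ⟨t, rfl, -⟩ := exists_append_of_prepend_eq h hl.le
  have : t = [] := by simpa using hl
  simp [this]

theorem eq_nil_of_forall_prepend_eq {t : Word} (h : ∀ ζ, ζ = prepend t ζ) : t = [] := by
  cases t with
  | nil => rfl
  | cons x t =>
    -- The constant sequence in the other letter cannot begin with `x`.
    have := congrFun (h fun _ => x + 1) 0
    simp [prepend] at this

theorem eq_of_forall_prepend_eq {u v : Word} (h : ∀ ζ, prepend u ζ = prepend v ζ) : u = v := by
  wlog hl : u.length ≤ v.length generalizing u v
  · exact (this (fun ζ => (h ζ).symm) (by omega)).symm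
  obtain ⟨t, rfl, -⟩ := exists_append_of_prepend_eq (h fun _ => 0) hl
  have : t = [] := eq_nil_of_forall_prepend_eq fun ζ =>
    prepend_injective u (by rw [h ζ, prepend_append])
  simp [this]

/-- Two cylinders that meet are nested, so one of the two extensions is empty. The bound on `b'` is
what makes local fineness additive. -/
theorem exists_common_refinement {a b : Word} {ξ η : Cantor} (h : prepend a ξ = prepend b η) :
    ∃ a' b' θ, a ++ a' = b ++ b' ∧ b'.length ≤ a.length ∧ ξ = prepend a' θ ∧
      η = prepend b' θ := by
  rcases le_total a.length b.length with hl | hl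
  · obtain ⟨t, rfl, ht⟩ := exists_append_of_prepend_eq h hl
    exact ⟨t, [], η, by simp, by simp, ht, rfl⟩
  · obtain ⟨t, rfl, ht⟩ := exists_append_of_prepend_eq h.symm hl
    exact ⟨[], t, ξ, by simp, by simp, rfl, ht⟩

/-- The cylinder `{wζ}`. -/
def cyl (w : Word) : Set Cantor := Set.range (prepend w)

theorem mem_toSet {R : Rect} {z : Cantor × Cantor} :
    z ∈ R.toSet ↔ z.1 ∈ cyl R.1 ∧ z.2 ∈ cyl R.2 := by
  constructor
  · rintro ⟨t, rfl⟩
    exact ⟨⟨_, rfl⟩, ⟨_, rfl⟩⟩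
  · rintro ⟨⟨s, hs⟩, ⟨t, ht⟩⟩
    exact ⟨(s, t), Prod.ext hs ht⟩

theorem cyl_nil : cyl [] = Set.univ := Set.eq_univ_of_forall fun ζ => ⟨ζ, rfl⟩

theorem prepend_head (ζ : Cantor) : prepend [ζ 0] (fun n => ζ (n + 1)) = ζ := by
  funext n
  cases n <;> rfl

theorem cyl_append_subset (u v : Word) : cyl (u ++ v) ⊆ cyl u := by
  rintro _ ⟨ζ, rfl⟩
  exact ⟨prepend v ζ, (prepend_append u v ζ).symm⟩

theorem exists_mem_cyl_append {w : Word} {ζ : Cantor} (h : ζ ∈ cyl w) :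
    ∃ x, ζ ∈ cyl (w ++ [x]) := by
  obtain ⟨η, rfl⟩ := h
  exact ⟨η 0, fun n => η (n + 1), by rw [prepend_append, prepend_head]⟩

theorem mem_cyl_cons {x : Fin 2} {w : Word} {ζ : Cantor} :
    prepend [x] ζ ∈ cyl (x :: w) ↔ ζ ∈ cyl w := by
  constructor
  · rintro ⟨η, h⟩
    exact ⟨η, (prepend_cons_inj.1 h).2⟩
  · rintro ⟨η, rfl⟩
    exact ⟨η, rfl⟩

theorem mem_cyl_cons_iff {x y : Fin 2} {w : Word} {ζ : Cantor} :
    prepend [x] ζ ∈ cyl (y :: w) ↔ y = x ∧ ζ ∈ cyl w := by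
  constructor
  · rintro ⟨η, h⟩
    exact ⟨(prepend_cons_inj.1 h).1, η, (prepend_cons_inj.1 h).2⟩
  · rintro ⟨rfl, h⟩
    exact mem_cyl_cons.2 h

theorem append_singleton_eq_of_mem_cyl {w : Word} {x y : Fin 2} {ζ : Cantor}
    (hx : ζ ∈ cyl (w ++ [x])) (hy : ζ ∈ cyl (w ++ [y])) : x = y := by
  obtain ⟨ξ, rfl⟩ := hx
  obtain ⟨η, h⟩ := hy
  have := eq_of_prepend_eq_of_length_eq h (by simp)
  simpa using this.symm

theorem pt_mem (R : Rect) (z : Cantor × Cantor) : R.pt z ∈ R.toSet := ⟨z, rfl⟩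

/-! ### Homeomorphisms that are affine on large rectangles -/

/-- Every point lies in the image `R'` of a rectangle `R` on which `g` changes prefixes, such
that the coordinates of `R'` have length at most `n`. -/
def LocallyFine (g : Homeo) (n : ℕ) : Prop :=
  ∀ z, ∃ R R', MapsRect g R R' ∧ z ∈ R'.toSet ∧ R'.1.length ≤ n ∧ R'.2.length ≤ n

theorem locallyFine_refl : LocallyFine (Homeomorph.refl _) 0 := fun z =>
  ⟨([], []), ([], []), fun _ => rfl, ⟨z, rfl⟩, le_rfl, le_rfl⟩

/-- Around the given point, the image rectangle `S'` of `s` meets the source rectangle `T` of `h`,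
and they are refined to their intersection. In each coordinate this extends `T`, hence also `T'`, by
at most the length of the word of `S'`, that is by at most `m` letters. -/
theorem LocallyFine.trans {s h : Homeo} {m n : ℕ} (hs : LocallyFine s m) (hh : LocallyFine h n) :
    LocallyFine (s.trans h) (m + n) := by
  intro z
  obtain ⟨T, T', hT, ⟨t, rfl⟩, hn₁, hn₂⟩ := hh z
  obtain ⟨S, S', hS, ⟨u, hu⟩, hm₁, hm₂⟩ := hs (T.pt t)
  obtain ⟨a, b, θ, hab, hl, -, ht⟩ := exists_common_refinement (congrArg Prod.fst hu)
  obtain ⟨a', b', θ', hab', hl', -, ht'⟩ := exists_common_refinement (congrArg Prod.snd hu)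
  refine ⟨(S.1 ++ a, S.2 ++ a'), (T'.1 ++ b, T'.2 ++ b'), fun z => ?_, ⟨(θ, θ'), ?_⟩, ?_, ?_⟩
  · have h1 : Rect.pt (S.1 ++ a, S.2 ++ a') z = S.pt (prepend a z.1, prepend a' z.2) := by
      simp [Rect.pt, prepend_append]
    have h2 : S'.pt (prepend a z.1, prepend a' z.2) =
        T.pt (prepend b z.1, prepend b' z.2) := by
      simp only [Rect.pt, ← prepend_append, hab, hab']
    have h3 : Rect.pt (T'.1 ++ b, T'.2 ++ b') z = T'.pt (prepend b z.1, prepend b' z.2) := by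
      simp [Rect.pt, prepend_append]
    rw [h1, h3, Homeomorph.trans_apply, hS, h2, hT]
  · simp [Rect.pt, prepend_append, ← ht, ← ht']
  · simp only [List.length_append]; omega
  · simp only [List.length_append]; omega

/-- If `g` maps `D` onto `R`, and the first coordinate of `R` is longer than what is needed to see
the action of `g`, then `g` is also affine on the union of `R` and its horizontal neighbour. -/
theorem LocallyFine.exists_sibling {g : Homeo} {n : ℕ} (hg : LocallyFine g n) {D R : Rect}
    (hDR : MapsRect g D R) {w : Word} {x : Fin 2} (hR : R.1 = w ++ [x]) (hw : n ≤ w.length) :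
    ∃ u, D.1 = u ++ [x] ∧ ∀ y, MapsRect g (u ++ [y], D.2) (w ++ [y], R.2) := by
  -- The second word of the rectangle supplied by `hg` may be longer than that of `R`, so the affine
  -- description is obtained on one horizontal line at a time.
  have key : ∀ ζ : Cantor, ∃ u, D.1 = u ++ [x] ∧
      ∀ η, g (prepend u η, prepend D.2 ζ) = (prepend w η, prepend R.2 ζ) := by
    intro ζ
    obtain ⟨Q, Q', hQ, ⟨t, ht⟩, hl, -⟩ := hg (prepend w (fun _ => 0), prepend R.2 ζ)
    -- Since `Q'.1` is no longer than `w`, it is a prefix of `w`, so `Q'` contains the whole line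
    -- over `w`, both halves included.
    obtain ⟨v, rfl, -⟩ := exists_append_of_prepend_eq (congrArg Prod.fst ht) (hl.trans hw)
    have ht2 : prepend Q'.2 t.2 = prepend R.2 ζ := congrArg Prod.snd ht
    have h1 : ∀ η, g (prepend (Q.1 ++ v) η, prepend Q.2 t.2) =
        (prepend (Q'.1 ++ v) η, prepend R.2 ζ) := by
      intro η
      have := hQ (prepend v η, t.2)
      simpa only [Rect.pt, prepend_append, ht2] using this
    -- On the half `x`, the description through `Q` must agree with the one through `D`. This
    -- identifies both the prefix `u` and the height of the line.
    have h2 : ∀ η, (prepend (Q.1 ++ v ++ [x]) η, prepend Q.2 t.2) =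
        (prepend D.1 η, prepend D.2 ζ) := by
      intro η
      apply g.injective
      have h3 := hDR (η, ζ)
      simp only [Rect.pt, hR] at h3
      rw [h3, prepend_append, h1, prepend_append _ [x]]
    have h4 : prepend Q.2 t.2 = prepend D.2 ζ := congrArg Prod.snd (h2 fun _ => 0)
    refine ⟨Q.1 ++ v, (eq_of_forall_prepend_eq fun η => congrArg Prod.fst (h2 η)).symm, ?_⟩
    rwa [← h4]
  -- The prefix does not depend on the line, because it is `D.1` without its last letter.
  obtain ⟨u, hu, -⟩ := key fun _ => 0
  refine ⟨u, hu, fun y z => ?_⟩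
  obtain ⟨u', hu', h⟩ := key z.2
  obtain rfl : u' = u := by simpa using hu'.symm.trans hu
  simpa only [Rect.pt, prepend_append] using h (prepend [y] z.1)

theorem MapsRect.symm {g : Homeo} {R R' : Rect} (h : MapsRect g R R') : MapsRect g.symm R' R :=
  fun z => by rw [← h z, Homeomorph.symm_apply_apply]

theorem MapsRect.symm_image {g : Homeo} {R R' : Rect} (h : MapsRect g R R') :
    g.symm '' R'.toSet = R.toSet := by
  ext z
  constructor
  · rintro ⟨_, ⟨t, rfl⟩, rfl⟩
    exact ⟨t, (h.symm t).symm⟩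
  · rintro ⟨t, rfl⟩
    exact ⟨R'.pt t, pt_mem _ _, h.symm t⟩

theorem MapsRect.dom_unique {g : Homeo} {R S R' : Rect} (h : MapsRect g R R')
    (h' : MapsRect g S R') : R = S := by
  have : ∀ z, R.pt z = S.pt z := fun z => g.injective ((h z).trans (h' z).symm)
  exact Prod.ext (eq_of_forall_prepend_eq fun ζ => congrArg Prod.fst (this (ζ, ζ)))
    (eq_of_forall_prepend_eq fun ζ => congrArg Prod.snd (this (ζ, ζ)))

/-! ### Interchanging the coordinates -/

/-- The conjugate of `g` by the exchange of the two coordinates. -/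
def swapHomeo (g : Homeo) : Homeo :=
  ((Homeomorph.prodComm Cantor Cantor).trans g).trans (Homeomorph.prodComm Cantor Cantor)

theorem swapHomeo_apply (g : Homeo) (z : Cantor × Cantor) :
    swapHomeo g z = (g z.swap).swap := rfl

theorem MapsRect.swap {g : Homeo} {R R' : Rect} (h : MapsRect g R R') :
    MapsRect (swapHomeo g) R.swap R'.swap := fun z => by
  rw [swapHomeo_apply]
  exact congrArg Prod.swap (h z.swap)

theorem LocallyFine.swap {g : Homeo} {n : ℕ} (hg : LocallyFine g n) :
    LocallyFine (swapHomeo g) n := by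
  intro z
  obtain ⟨R, R', h, hz, h1, h2⟩ := hg z.swap
  exact ⟨R.swap, R'.swap, h.swap, mem_toSet.2 (mem_toSet.1 hz).symm, h2, h1⟩

/-! ### Essential rectangles of locally fine homeomorphisms -/

theorem exists_eq_append_of_length_lt {w : Word} {n : ℕ} (h : n < w.length) :
    ∃ u x, w = u ++ [x] ∧ n ≤ u.length := by
  have hne : w ≠ [] := by rintro rfl; simp at h
  refine ⟨w.dropLast, w.getLast hne, (List.dropLast_append_getLast hne).symm, ?_⟩
  rw [List.length_dropLast]; omega

theorem LocallyFine.vertReducible {g : Homeo} {n : ℕ} (hg : LocallyFine g n) {D R : Rect}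
    (hDR : MapsRect g D R) (hR : n < R.1.length) : VertReducible g R := by
  obtain ⟨w, x, hw, hl⟩ := exists_eq_append_of_length_lt hR
  obtain ⟨u, hu, hy⟩ := hg.exists_sibling hDR hw hl
  refine ⟨w, u, D.2, x, x + 1, by simp, hw, ?_, (hy _).symm⟩
  rw [← hu]
  exact hDR.symm_image

theorem LocallyFine.horizReducible {g : Homeo} {n : ℕ} (hg : LocallyFine g n) {D R : Rect}
    (hDR : MapsRect g D R) (hR : n < R.2.length) : HorizReducible g R := by
  obtain ⟨w, x, hw, hl⟩ := exists_eq_append_of_length_lt hR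
  obtain ⟨u, hu, hy⟩ := hg.swap.exists_sibling hDR.swap hw hl
  refine ⟨w, D.1, u, x, x + 1, by simp, hw, ?_, (hy _).swap.symm⟩
  have : D.2 = u ++ [x] := hu
  rw [← this]
  exact hDR.symm_image

/-! ### The generators -/

theorem IsPattern.exists_mem {P : Finset Rect} (hP : IsPattern P) (z : Cantor × Cantor) :
    ∃ R ∈ P, z ∈ R.toSet := by
  induction hP with
  | trivial => exact ⟨([], []), by simp, ⟨z, rfl⟩⟩
  | @vert P R hP hR ih =>
    obtain ⟨S, hS, hz⟩ := ih
    by_cases h : S = R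
    · subst h
      obtain ⟨x, hx⟩ := exists_mem_cyl_append (mem_toSet.1 hz).1
      refine ⟨S.vhalf x, ?_, mem_toSet.2 ⟨hx, (mem_toSet.1 hz).2⟩⟩
      fin_cases x <;> simp
    · exact ⟨S, by simp [h, hS], hz⟩
  | @horiz P R hP hR ih =>
    obtain ⟨S, hS, hz⟩ := ih
    by_cases h : S = R
    · subst h
      obtain ⟨x, hx⟩ := exists_mem_cyl_append (mem_toSet.1 hz).2
      refine ⟨S.hhalf x, ?_, mem_toSet.2 ⟨(mem_toSet.1 hz).1, hx⟩⟩
      fin_cases x <;> simp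
    · exact ⟨S, by simp [h, hS], hz⟩

/-- Each word of a rectangle is no longer than the size of the rectangle; the inverse is handled by
reading the pair backwards. -/
theorem locallyFine_of_mem_depthAtMost {d : ℕ} {g : Homeo} (hg : g ∈ depthAtMost d) :
    LocallyFine g d ∧ LocallyFine g.symm d := by
  obtain ⟨p, hp, hdom, htgt⟩ := hg
  constructor
  · intro z
    obtain ⟨R, hR, hz⟩ := p.tgt_isPattern.exists_mem z
    have : R.size ≤ d := (Finset.le_sup (f := Rect.size) hR).trans htgt
    obtain ⟨c, hc, rfl⟩ := Finset.mem_image.1 hR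
    rw [Rect.size] at this
    exact ⟨c.1, c.2, hp c hc, hz, by omega, by omega⟩
  · intro z
    obtain ⟨R, hR, hz⟩ := p.dom_isPattern.exists_mem z
    have : R.size ≤ d := (Finset.le_sup (f := Rect.size) hR).trans hdom
    obtain ⟨c, hc, rfl⟩ := Finset.mem_image.1 hR
    rw [Rect.size] at this
    exact ⟨c.2, c.1, (hp c hc).symm, hz, by omega, by omega⟩

/-- The address, inside the half of the Cantor set with index `x`, of the part in that half of the
cylinder of a word. -/
def restrictWord (x : Fin 2) : Word → Option Word
  | [] => some []
  | y :: w => if y = x then some w else none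

theorem mem_cyl_of_restrictWord {x : Fin 2} {v w : Word} {ζ : Cantor}
    (h : restrictWord x v = some w) (hζ : ζ ∈ cyl w) : prepend [x] ζ ∈ cyl v := by
  cases v with
  | nil => exact ⟨_, rfl⟩
  | cons y v =>
    simp only [restrictWord] at h
    split_ifs at h with hy
    obtain rfl := Option.some.inj h
    exact mem_cyl_cons_iff.2 ⟨hy, hζ⟩

/-- A test, by at most `n` successive bisections, for `L` to cover the Cantor square. -/
def coversBy : ℕ → List Rect → Bool
  | 0, L => L.any fun R => R.1.isEmpty && R.2.isEmpty
  | n + 1, L => (L.any fun R => R.1.isEmpty && R.2.isEmpty) ||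
      bif L.all fun R => R.1.isEmpty then
        coversBy n (L.filterMap fun R => (restrictWord 0 R.2).map fun w => (R.1, w)) &&
        coversBy n (L.filterMap fun R => (restrictWord 1 R.2).map fun w => (R.1, w))
      else
        coversBy n (L.filterMap fun R => (restrictWord 0 R.1).map fun w => (w, R.2)) &&
        coversBy n (L.filterMap fun R => (restrictWord 1 R.1).map fun w => (w, R.2))

theorem exists_mem_of_any_isEmpty {L : List Rect}
    (h : (L.any fun R => R.1.isEmpty && R.2.isEmpty) = true) (z : Cantor × Cantor) :
    ∃ R ∈ L, z ∈ R.toSet := by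
  obtain ⟨⟨a, b⟩, hR, h⟩ := List.any_eq_true.1 h
  simp only [Bool.and_eq_true, List.isEmpty_iff] at h
  obtain ⟨rfl, rfl⟩ := h
  exact ⟨_, hR, z, rfl⟩

theorem exists_mem_of_coversBy {n : ℕ} {L : List Rect} (h : coversBy n L = true)
    (z : Cantor × Cantor) : ∃ R ∈ L, z ∈ R.toSet := by
  induction n generalizing L z with
  | zero => exact exists_mem_of_any_isEmpty h z
  | succ n ih =>
    have hfirst : ∀ x, coversBy n (L.filterMap fun R =>
        (restrictWord x R.1).map fun w => (w, R.2)) = true → z.1 0 = x →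
        ∃ R ∈ L, z ∈ R.toSet := by
      rintro _ h rfl
      obtain ⟨S, hS, hz⟩ := ih h (fun n => z.1 (n + 1), z.2)
      obtain ⟨R, hR, hRS⟩ := List.mem_filterMap.1 hS
      obtain ⟨w, hw, rfl⟩ := Option.map_eq_some_iff.1 hRS
      have := mem_cyl_of_restrictWord hw (mem_toSet.1 hz).1
      rw [prepend_head] at this
      exact ⟨R, hR, mem_toSet.2 ⟨this, (mem_toSet.1 hz).2⟩⟩
    have hsecond : ∀ x, coversBy n (L.filterMap fun R =>
        (restrictWord x R.2).map fun w => (R.1, w)) = true → z.2 0 = x →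
        ∃ R ∈ L, z ∈ R.toSet := by
      rintro _ h rfl
      obtain ⟨S, hS, hz⟩ := ih h (z.1, fun n => z.2 (n + 1))
      obtain ⟨R, hR, hRS⟩ := List.mem_filterMap.1 hS
      obtain ⟨w, hw, rfl⟩ := Option.map_eq_some_iff.1 hRS
      have := mem_cyl_of_restrictWord hw (mem_toSet.1 hz).2
      rw [prepend_head] at this
      exact ⟨R, hR, mem_toSet.2 ⟨(mem_toSet.1 hz).1, this⟩⟩
    have hbit : ∀ x : Fin 2, x = 0 ∨ x = 1 := by decide
    rw [coversBy, Bool.or_eq_true] at h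
    rcases h with h | h
    · exact exists_mem_of_any_isEmpty h z
    · cases hall : L.all fun R => R.1.isEmpty
      · rw [hall, cond_false, Bool.and_eq_true] at h
        exact (hbit (z.1 0)).elim (hfirst 0 h.1) (hfirst 1 h.2)
      · rw [hall, cond_true, Bool.and_eq_true] at h
        exact (hbit (z.2 0)).elim (hsecond 0 h.1) (hsecond 1 h.2)

/-- Local fineness only asks that the rectangles cover, so neither disjointness nor the pattern
property has to be checked. A bisection shortens all nonempty words in the chosen coordinate, and
seven bisections are ample for these short tables. -/
theorem generatorTables_cover : ∀ t ∈ generatorTables,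
    coversBy 7 (t.map Prod.fst) = true ∧ coversBy 7 (t.map Prod.snd) = true := by
  decide +kernel

theorem generatorTables_length_le : ∀ t ∈ generatorTables, ∀ c ∈ t,
    (c.1.1.length ≤ 4 ∧ c.1.2.length ≤ 4) ∧ c.2.1.length ≤ 4 ∧ c.2.2.length ≤ 4 := by
  decide +kernel

theorem locallyFine_of_mem_X2V {g : Homeo} (hg : g ∈ X2V) :
    LocallyFine g 4 ∧ LocallyFine g.symm 4 := by
  obtain ⟨t, ht, h⟩ := hg
  constructor
  · intro z
    obtain ⟨R, hR, hz⟩ := exists_mem_of_coversBy (generatorTables_cover t ht).2 z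
    obtain ⟨c, hc, rfl⟩ := List.mem_map.1 hR
    exact ⟨c.1, c.2, h c hc, hz, (generatorTables_length_le t ht c hc).2⟩
  · intro z
    obtain ⟨R, hR, hz⟩ := exists_mem_of_coversBy (generatorTables_cover t ht).1 z
    obtain ⟨c, hc, rfl⟩ := List.mem_map.1 hR
    exact ⟨c.2, c.1, (h c hc).symm, hz, (generatorTables_length_le t ht c hc).1⟩

/-! ### Words in the generators and word length. -/

theorem locallyFine_evalWord {d : ℕ} {l : List Homeo} (h : ∀ s ∈ l, LocallyFine s d) :
    LocallyFine (evalWord l) (d * l.length) := by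
  induction l with
  | nil => exact locallyFine_refl
  | cons s l ih =>
    have := (h s (by simp)).trans (ih fun s hs => h s (by simp [hs]))
    rw [List.length_cons, Nat.mul_succ, Nat.add_comm]
    exact this

/-- A nonempty infimum in `ℕ∞` is attained by some word. Without any word the length is `⊤`, and `d
≠ 0` is needed because `0 * ⊤ = 0`. -/
theorem le_mul_wordLength {X : Set Homeo} {g : Homeo} {k d : ℕ}
    (h : ∀ l : List Homeo, (∀ s ∈ l, s ∈ X ∨ s.symm ∈ X) → evalWord l = g → k ≤ d * l.length)
    (hd : d ≠ 0) : (k : ℕ∞) ≤ d * wordLength X g := by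
  by_cases hne : ∃ l : List Homeo, (∀ s ∈ l, s ∈ X ∨ s.symm ∈ X) ∧ evalWord l = g
  · obtain ⟨l, hl, heq⟩ : ∃ l ∈ {l : List Homeo | (∀ s ∈ l, s ∈ X ∨ s.symm ∈ X) ∧
        evalWord l = g}, (l.length : ℕ∞) = wordLength X g := by
      have := csInf_mem (s := (fun l : List Homeo => (l.length : ℕ∞)) '' {l : List Homeo |
        (∀ s ∈ l, s ∈ X ∨ s.symm ∈ X) ∧ evalWord l = g}) (Set.Nonempty.image _ hne)
      rwa [sInf_image] at this
    rw [← heq]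
    exact_mod_cast h l hl.1 hl.2
  · have : wordLength X g = ⊤ := by
      simp only [wordLength, iInf_eq_top]
      exact fun l hl => (hne ⟨l, hl⟩).elim
    rw [this, ENat.mul_top (by exact_mod_cast hd)]
    exact le_top


/-! ### Tilings -/

/-- The sets `s c`, for `c ∈ C`, partition the whole space. -/
def IsTiling {ι α : Type*} (s : ι → Set α) (C : Finset ι) : Prop :=
  ∀ z, ∃! c, c ∈ C ∧ z ∈ s c

theorem IsTiling.exists_mem {ι α : Type*} {s : ι → Set α} {C : Finset ι} (h : IsTiling s C)
    (z : α) : ∃ c ∈ C, z ∈ s c := (h z).exists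

theorem IsTiling.unique {ι α : Type*} {s : ι → Set α} {C : Finset ι} (h : IsTiling s C)
    {z : α} {c d : ι} (hc : c ∈ C) (hd : d ∈ C) (hzc : z ∈ s c) (hzd : z ∈ s d) : c = d :=
  (h z).unique ⟨hc, hzc⟩ ⟨hd, hzd⟩

theorem isTiling_of {ι α : Type*} {s : ι → Set α} {C : Finset ι}
    (h₁ : ∀ z, ∃ c ∈ C, z ∈ s c)
    (h₂ : ∀ z, ∀ c ∈ C, ∀ d ∈ C, z ∈ s c → z ∈ s d → c = d) : IsTiling s C := by
  intro z
  obtain ⟨c, hc, hz⟩ := h₁ z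
  exact ⟨c, ⟨hc, hz⟩, fun d hd => h₂ z d hd.1 c hc hd.2 hz⟩

/-- A merged tile is the union of the old tiles sent to it. A point in two merged tiles therefore
lies in an old tile of each; these coincide, and so do the merged tiles. -/
theorem IsTiling.image_merge {ι α : Type*} [DecidableEq ι] {s : ι → Set α} {C : Finset ι}
    (h : IsTiling s C) (m : ι → ι) (h₁ : ∀ c ∈ C, s c ⊆ s (m c))
    (h₂ : ∀ c ∈ C, ∀ z ∈ s (m c), ∃ e ∈ C, m e = m c ∧ z ∈ s e) : IsTiling s (C.image m) := by
  refine isTiling_of (fun z => ?_) fun z c hc d hd hzc hzd => ?_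
  · obtain ⟨c, hc, hz⟩ := h.exists_mem z
    exact ⟨m c, Finset.mem_image_of_mem _ hc, h₁ c hc hz⟩
  · obtain ⟨c, hc', rfl⟩ := Finset.mem_image.1 hc
    obtain ⟨d, hd', rfl⟩ := Finset.mem_image.1 hd
    obtain ⟨e, he, hec, hze⟩ := h₂ c hc' z hzc
    obtain ⟨f, hf, hfd, hzf⟩ := h₂ d hd' z hzd
    rw [← hec, ← hfd, h.unique he hf hze hzf]

/-- Nonempty tiles with equal labels would overlap, so a tiling indexed by cells already encodes the
injectivity of the numbering. This lets the domain or the target of a pair be treated as one tiling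
by its cells. -/
theorem isTiling_image {ι κ α : Type*} [DecidableEq κ] {s : κ → Set α} {f : ι → κ}
    (hs : ∀ k, (s k).Nonempty) {C : Finset ι} :
    IsTiling (s ∘ f) C ↔ Set.InjOn f C ∧ IsTiling s (C.image f) := by
  constructor
  · intro h
    have hinj : Set.InjOn f C := fun c hc d hd hcd => by
      obtain ⟨z, hz⟩ := hs (f c)
      exact h.unique hc hd hz (hcd ▸ hz : z ∈ s (f d))
    refine ⟨hinj, isTiling_of (fun z => ?_) fun z a ha b hb hza hzb => ?_⟩
    · obtain ⟨c, hc, hz⟩ := h.exists_mem z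
      exact ⟨f c, Finset.mem_image_of_mem _ hc, hz⟩
    · obtain ⟨c, hc, rfl⟩ := Finset.mem_image.1 ha
      obtain ⟨d, hd, rfl⟩ := Finset.mem_image.1 hb
      rw [h.unique hc hd hza hzb]
  · rintro ⟨hinj, h⟩
    refine isTiling_of (fun z => ?_) fun z c hc d hd hzc hzd => ?_
    · obtain ⟨a, ha, hz⟩ := h.exists_mem z
      obtain ⟨c, hc, rfl⟩ := Finset.mem_image.1 ha
      exact ⟨c, hc, hz⟩
    · exact hinj hc hd (h.unique (Finset.mem_image_of_mem _ hc) (Finset.mem_image_of_mem _ hd)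
        hzc hzd)

theorem toSet_nonempty (R : Rect) : R.toSet.Nonempty := Set.range_nonempty _

theorem cyl_nonempty (w : Word) : (cyl w).Nonempty := Set.range_nonempty _

/-- Replacing a tile by two halves. -/
theorem IsTiling.subdivide {ι α : Type*} [DecidableEq ι] {s : ι → Set α} {P : Finset ι}
    (h : IsTiling s P) {R : ι} (hR : R ∈ P) {f : Fin 2 → ι}
    (hf : ∀ z, z ∈ s R ↔ ∃ x, z ∈ s (f x)) (hf' : ∀ z x y, z ∈ s (f x) → z ∈ s (f y) → x = y) :
    IsTiling s (P.erase R ∪ {f 0, f 1}) := by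
  have hmem : ∀ c, c ∈ P.erase R ∪ {f 0, f 1} ↔ (c ≠ R ∧ c ∈ P) ∨ ∃ x, c = f x := by
    intro c
    simp only [Finset.mem_union, Finset.mem_erase, Finset.mem_insert, Finset.mem_singleton,
      Fin.exists_fin_two, ne_eq]
  refine isTiling_of (fun z => ?_) fun z c hc d hd hzc hzd => ?_
  · obtain ⟨c, hc, hz⟩ := h.exists_mem z
    by_cases hcR : c = R
    · obtain ⟨x, hx⟩ := (hf z).1 (hcR ▸ hz)
      exact ⟨f x, (hmem _).2 (Or.inr ⟨x, rfl⟩), hx⟩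
    · exact ⟨c, (hmem _).2 (Or.inl ⟨hcR, hc⟩), hz⟩
  · rcases (hmem c).1 hc with ⟨hcR, hc⟩ | ⟨x, rfl⟩ <;> rcases (hmem d).1 hd with ⟨hdR, hd⟩ | ⟨y, rfl⟩
    · exact h.unique hc hd hzc hzd
    · exact (hcR (h.unique hc hR hzc ((hf z).2 ⟨y, hzd⟩))).elim
    · exact (hdR (h.unique hd hR hzd ((hf z).2 ⟨x, hzc⟩))).elim
    · rw [hf' z x y hzc hzd]

theorem mem_cyl_iff_exists_append {w : Word} {ζ : Cantor} :
    ζ ∈ cyl w ↔ ∃ x, ζ ∈ cyl (w ++ [x]) :=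
  ⟨exists_mem_cyl_append, fun ⟨_, hx⟩ => cyl_append_subset _ _ hx⟩

theorem IsPattern.isTiling {P : Finset Rect} (hP : IsPattern P) : IsTiling Rect.toSet P := by
  induction hP with
  | trivial =>
    exact isTiling_of (fun z => ⟨([], []), by simp, ⟨z, rfl⟩⟩) fun z c hc d hd _ _ => by
      rw [Finset.mem_singleton.1 hc, Finset.mem_singleton.1 hd]
  | @vert P R hP hR ih =>
    refine ih.subdivide (f := R.vhalf) hR (fun z => ?_) fun z x y hx hy => ?_
    · simp only [mem_toSet, Rect.vhalf, mem_cyl_iff_exists_append (w := R.1)]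
      exact exists_and_right.symm
    · exact append_singleton_eq_of_mem_cyl (mem_toSet.1 hx).1 (mem_toSet.1 hy).1
  | @horiz P R hP hR ih =>
    refine ih.subdivide (f := R.hhalf) hR (fun z => ?_) fun z x y hx hy => ?_
    · simp only [mem_toSet, Rect.hhalf, mem_cyl_iff_exists_append (w := R.2)]
      exact exists_and_left.symm
    · exact append_singleton_eq_of_mem_cyl (mem_toSet.1 hx).2 (mem_toSet.1 hy).2

/-! ### Every tiling of the Cantor square by rectangles is a pattern -/

/-- The subrectangle of `R` with relative address `Q`. -/
def Rect.sub (R Q : Rect) : Rect := (R.1 ++ Q.1, R.2 ++ Q.2)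

theorem Rect.sub_injective (R : Rect) : Function.Injective R.sub := fun Q Q' h => by
  simp only [Rect.sub, Prod.mk.injEq, List.append_cancel_left_eq] at h
  exact Prod.ext h.1 h.2

theorem Rect.sub_toSet_subset (R Q : Rect) : (R.sub Q).toSet ⊆ R.toSet := fun _ hz =>
  mem_toSet.2 ⟨cyl_append_subset _ _ (mem_toSet.1 hz).1, cyl_append_subset _ _ (mem_toSet.1 hz).2⟩

theorem erase_union_image_subdivide {ι : Type*} [DecidableEq ι] {P Q : Finset ι} {f : ι → ι}
    (hf : Function.Injective f) {S : ι} (hS : f S ∉ P) (A : Finset ι) :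
    P ∪ (Q.erase S ∪ A).image f = (P ∪ Q.image f).erase (f S) ∪ A.image f := by
  rw [Finset.image_union, Finset.image_erase hf, Finset.erase_union_distrib,
    Finset.erase_eq_of_notMem hS, Finset.union_assoc]

/-- Replacing a rectangle of a pattern by a copy of another pattern. -/
theorem IsPattern.substitute {P Q : Finset Rect} (hP : IsPattern P) {R : Rect} (hR : R ∈ P)
    (hQ : IsPattern Q) : IsPattern (P.erase R ∪ Q.image R.sub) := by
  -- A copy placed inside `R` cannot be one of the other tiles, so erasing it later leaves them
  -- untouched.
  have hnot : ∀ S, R.sub S ∉ P.erase R := fun S hS => by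
    obtain ⟨z, hz⟩ := toSet_nonempty (R.sub S)
    exact (Finset.mem_erase.1 hS).1 (hP.isTiling.unique (Finset.mem_of_mem_erase hS) hR hz
      (R.sub_toSet_subset S hz))
  induction hQ with
  | trivial =>
    have : P.erase R ∪ ({([], [])} : Finset Rect).image R.sub = P := by
      ext S
      simp only [Finset.image_singleton, Rect.sub, List.append_nil, Finset.mem_union,
        Finset.mem_erase, Finset.mem_singleton]
      by_cases h : S = R <;> simp [h, hR]
    rwa [this]
  | @vert Q S hQ hS ih =>
    rw [erase_union_image_subdivide R.sub_injective (hnot S)]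
    have := ih.vert (R := R.sub S) (Finset.mem_union_right _ (Finset.mem_image_of_mem _ hS))
    simpa [Finset.image_insert, Rect.sub, Rect.vhalf] using this
  | @horiz Q S hQ hS ih =>
    rw [erase_union_image_subdivide R.sub_injective (hnot S)]
    have := ih.horiz (R := R.sub S) (Finset.mem_union_right _ (Finset.mem_image_of_mem _ hS))
    simpa [Finset.image_insert, Rect.sub, Rect.hhalf] using this

theorem isPattern_halves {P : Fin 2 → Finset Rect} (hP : ∀ x, IsPattern (P x))
    {f : Fin 2 → Rect} (h : IsPattern {f 0, f 1}) (hne : f 0 ≠ f 1)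
    (hf : ∀ Q, (f 0).sub Q ≠ f 1) :
    IsPattern ((P 0).image (f 0).sub ∪ (P 1).image (f 1).sub) := by
  have h1 := h.substitute (R := f 0) (by simp) (hP 0)
  have h2 := h1.substitute (R := f 1) (by simp [hne.symm]) (hP 1)
  have h3 : ({f 0, f 1} : Finset Rect).erase (f 0) = {f 1} := by
    simp [hne]
  have h4 : f 1 ∉ (P 0).image (f 0).sub := by
    simpa using fun a b _ => hf (a, b)
  rw [h3, Finset.erase_union_distrib, Finset.erase_eq_of_notMem h4] at h2
  simpa using h2

theorem IsTiling.eq_singleton {P : Finset Rect} (h : IsTiling Rect.toSet P)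
    (h' : ([], []) ∈ P) : P = {([], [])} := by
  refine Finset.eq_singleton_iff_unique_mem.2 ⟨h', fun R hR => ?_⟩
  obtain ⟨z, hz⟩ := toSet_nonempty R
  exact h.unique hR h' hz ⟨z, rfl⟩

/-- The part of `P` in the half with index `x`, as a set of rectangles of the whole square. -/
theorem IsTiling.half {P : Finset Rect} (h : IsTiling Rect.toSet P) {f : Rect → Rect}
    (hf : Function.Injective f) {e : Cantor × Cantor → Cantor × Cantor}
    (he : ∀ z S, e z ∈ S.toSet → S ∈ P → ∃ Q, S = f Q)
    (hfe : ∀ z Q, e z ∈ (f Q).toSet ↔ z ∈ Q.toSet) :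
    IsTiling Rect.toSet (P.preimage f hf.injOn) := by
  refine isTiling_of (fun z => ?_) fun z c hc d hd hzc hzd => ?_
  · obtain ⟨S, hS, hz⟩ := h.exists_mem (e z)
    obtain ⟨Q, rfl⟩ := he z S hz hS
    exact ⟨Q, Finset.mem_preimage.2 hS, (hfe z Q).1 hz⟩
  · exact hf (h.unique (Finset.mem_preimage.1 hc) (Finset.mem_preimage.1 hd)
      ((hfe z c).2 hzc) ((hfe z d).2 hzd))

/-- A nontrivial tiling is always cut by the vertical or the horizontal midline of the square. The
two halves, rescaled, are tilings of smaller size, and the induction applies to them. -/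
theorem IsTiling.isPattern_of_size_le {n : ℕ} : ∀ {P : Finset Rect}, IsTiling Rect.toSet P →
    (∀ R ∈ P, R.size ≤ n) → IsPattern P := by
  induction n with
  | zero =>
    intro P hP hn
    obtain ⟨R, hR, -⟩ := hP.exists_mem (fun _ => 0, fun _ => 0)
    have h := hn R hR
    simp only [Rect.size, Nat.le_zero, Nat.add_eq_zero_iff, List.length_eq_zero_iff] at h
    have hR' : R = ([], []) := Prod.ext h.1 h.2
    rw [hP.eq_singleton (hR' ▸ hR)]
    exact .trivial
  | succ n ih =>
    intro P hP hn
    by_cases h1 : ∀ R ∈ P, R.1 ≠ []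
    · let f : Fin 2 → Rect := fun x => ([x], [])
      have hf : ∀ R ∈ P, ∃ x Q, R = (f x).sub Q := by
        intro R hR
        obtain ⟨x, w, hw⟩ := List.exists_cons_of_ne_nil (h1 R hR)
        exact ⟨x, (w, R.2), Prod.ext hw rfl⟩
      have hhalf : ∀ x, IsPattern (P.preimage (f x).sub (f x).sub_injective.injOn) := by
        intro x
        refine ih (hP.half (f x).sub_injective (e := fun z => (prepend [x] z.1, z.2))
          (fun z S hz hS => ?_) fun z Q => ?_) fun R hR => ?_
        · obtain ⟨y, Q, rfl⟩ := hf S hS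
          obtain rfl := (mem_cyl_cons_iff.1 (mem_toSet.1 hz).1).1
          exact ⟨Q, rfl⟩
        · rw [mem_toSet, mem_toSet]
          exact and_congr_left' mem_cyl_cons
        · have := hn _ (Finset.mem_preimage.1 hR)
          simp only [f, Rect.sub, Rect.size, List.length_append, List.length_singleton,
            List.nil_append] at this ⊢
          omega
      have h2 : IsPattern {f 0, f 1} := by
        simpa [f, Rect.vhalf] using IsPattern.trivial.vert (R := ([], [])) (by simp)
      have h3 := isPattern_halves hhalf h2 (by simp [f]) (by simp [f, Rect.sub])
      convert h3 using 1
      ext R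
      simp only [Finset.mem_union, Finset.mem_image, Finset.mem_preimage]
      constructor
      · intro hR
        obtain ⟨x, Q, rfl⟩ := hf R hR
        fin_cases x
        · exact Or.inl ⟨Q, hR, rfl⟩
        · exact Or.inr ⟨Q, hR, rfl⟩
      · rintro (⟨Q, hQ, rfl⟩ | ⟨Q, hQ, rfl⟩) <;> exact hQ
    · by_cases h1' : ∀ R ∈ P, R.2 ≠ []
      · let f : Fin 2 → Rect := fun x => ([], [x])
        have hf : ∀ R ∈ P, ∃ x Q, R = (f x).sub Q := by
          intro R hR
          obtain ⟨x, w, hw⟩ := List.exists_cons_of_ne_nil (h1' R hR)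
          exact ⟨x, (R.1, w), Prod.ext rfl hw⟩
        have hhalf : ∀ x, IsPattern (P.preimage (f x).sub (f x).sub_injective.injOn) := by
          intro x
          refine ih (hP.half (f x).sub_injective (e := fun z => (z.1, prepend [x] z.2))
            (fun z S hz hS => ?_) fun z Q => ?_) fun R hR => ?_
          · obtain ⟨y, Q, rfl⟩ := hf S hS
            obtain rfl := (mem_cyl_cons_iff.1 (mem_toSet.1 hz).2).1
            exact ⟨Q, rfl⟩
          · rw [mem_toSet, mem_toSet]
            exact and_congr_right' mem_cyl_cons
          · have := hn _ (Finset.mem_preimage.1 hR)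
            simp only [f, Rect.sub, Rect.size, List.length_append, List.length_singleton,
              List.nil_append] at this ⊢
            omega
        have h2 : IsPattern {f 0, f 1} := by
          simpa [f, Rect.hhalf] using IsPattern.trivial.horiz (R := ([], [])) (by simp)
        have h3 := isPattern_halves hhalf h2 (by simp [f]) (by simp [f, Rect.sub])
        convert h3 using 1
        ext R
        simp only [Finset.mem_union, Finset.mem_image, Finset.mem_preimage]
        constructor
        · intro hR
          obtain ⟨x, Q, rfl⟩ := hf R hR
          fin_cases x
          · exact Or.inl ⟨Q, hR, rfl⟩
          · exact Or.inr ⟨Q, hR, rfl⟩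
        · rintro (⟨Q, hQ, rfl⟩ | ⟨Q, hQ, rfl⟩) <;> exact hQ
      -- A tile of full width and a tile of full height cross, so they are the same tile, the whole
      -- square.
      · push Not at h1 h1'
        obtain ⟨R, hR, hR1⟩ := h1
        obtain ⟨S, hS, hS2⟩ := h1'
        obtain ⟨ζ, hζ⟩ := cyl_nonempty S.1
        obtain ⟨η, hη⟩ := cyl_nonempty R.2
        have hRS : R = S := hP.unique (z := (ζ, η)) hR hS
          (mem_toSet.2 ⟨by simp [hR1, cyl_nil], hη⟩) (mem_toSet.2 ⟨hζ, by simp [hS2, cyl_nil]⟩)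
        have hR' : R = ([], []) := Prod.ext hR1 (hRS ▸ hS2)
        rw [hP.eq_singleton (hR' ▸ hR)]
        exact .trivial

theorem isPattern_iff_isTiling {P : Finset Rect} : IsPattern P ↔ IsTiling Rect.toSet P :=
  ⟨IsPattern.isTiling, fun h => h.isPattern_of_size_le fun _ hR =>
    Finset.le_sup (f := Rect.size) hR⟩

/-! ### Prefix codes and grid patterns -/

/-- Complete prefix codes: the subdivisions of the unit interval into dyadic intervals. -/
abbrev IsCode (A : Finset Word) : Prop := IsTiling cyl A

theorem IsCode.eq_nil_of_append_mem {A : Finset Word} (hA : IsCode A) {u v : Word} (hu : u ∈ A)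
    (hv : u ++ v ∈ A) : v = [] := by
  obtain ⟨ζ, hζ⟩ := cyl_nonempty (u ++ v)
  simpa using (hA.unique hu hv (cyl_append_subset _ _ hζ) hζ)

/-- The sibling of a longest word of a complete prefix code belongs to the code. -/
theorem IsCode.sibling_mem {A : Finset Word} (hA : IsCode A) {w : Word} {x : Fin 2}
    (hw : w ++ [x] ∈ A) (hmax : ∀ a ∈ A, a.length ≤ w.length + 1) (y : Fin 2) :
    w ++ [y] ∈ A := by
  -- The codeword `a` covers a point over `w ++ [y]` and is not longer, so it is a prefix of it. A
  -- proper prefix would also be a prefix of the codeword `w ++ [x]`.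
  obtain ⟨a, ha, η, hη⟩ := hA.exists_mem (prepend (w ++ [y]) fun _ => 0)
  obtain ⟨t, ht, -⟩ := exists_append_of_prepend_eq hη (by simpa using hmax a ha)
  rcases List.eq_nil_or_concat t with rfl | ⟨t, z, rfl⟩
  · simpa [ht] using ha
  · rw [List.concat_eq_append, ← List.append_assoc] at ht
    obtain rfl := (List.append_inj' ht rfl).1
    simpa using hA.eq_nil_of_append_mem ha (v := t ++ [x]) (by simpa using hw)

/-- Merges the two halves of the interval `w`. -/
def mergeWord (w a : Word) : Word := if ∃ x, a = w ++ [x] then w else a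

/-- Subdivides the interval `w`. -/
def splitAt (w : Word) (A : Finset Word) : Finset Word :=
  A.biUnion fun a => if a = w then {w ++ [0], w ++ [1]} else {a}

theorem mem_splitAt {w a : Word} {A : Finset Word} :
    a ∈ splitAt w A ↔ (a ∈ A ∧ a ≠ w) ∨ (w ∈ A ∧ ∃ x, a = w ++ [x]) := by
  simp only [splitAt, Finset.mem_biUnion]
  constructor
  · rintro ⟨b, hb, h⟩
    split_ifs at h with hbw
    · subst hbw
      exact Or.inr ⟨hb, by simpa [Fin.exists_fin_two] using h⟩
    · obtain rfl := Finset.mem_singleton.1 h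
      exact Or.inl ⟨hb, hbw⟩
  · rintro (⟨ha, h⟩ | ⟨hw, h⟩)
    · exact ⟨a, ha, by simp [h]⟩
    · exact ⟨w, hw, by simpa [Fin.exists_fin_two] using h⟩

theorem IsCode.notMem_of_children {A : Finset Word} (hA : IsCode A) {w : Word}
    (hw : ∀ x, w ++ [x] ∈ A) : w ∉ A := fun h => by
  simpa using hA.eq_nil_of_append_mem h (hw 0)

theorem IsCode.merge {A : Finset Word} (hA : IsCode A) {w : Word} (hw : ∀ x, w ++ [x] ∈ A) :
    IsCode (A.image (mergeWord w)) := by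
  refine hA.image_merge _ (fun a _ => ?_) fun a ha ζ hζ => ?_
  · unfold mergeWord
    split_ifs with h
    · obtain ⟨x, rfl⟩ := h
      exact cyl_append_subset _ _
    · exact subset_rfl
  · by_cases h : ∃ x, a = w ++ [x]
    · simp only [mergeWord, if_pos h] at hζ
      obtain ⟨y, hy⟩ := exists_mem_cyl_append hζ
      exact ⟨w ++ [y], hw y, by simp [mergeWord, h], hy⟩
    · exact ⟨a, ha, rfl, by simpa [mergeWord, h] using hζ⟩

theorem mem_image_mergeWord {A : Finset Word} {w : Word} (hw : ∀ x, w ++ [x] ∈ A) {a : Word} :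
    a ∈ A.image (mergeWord w) ↔ a = w ∨ (a ∈ A ∧ ¬ ∃ x, a = w ++ [x]) := by
  rw [Finset.mem_image]
  constructor
  · rintro ⟨b, hb, rfl⟩
    by_cases h : ∃ x, b = w ++ [x]
    · exact Or.inl (if_pos h)
    · rw [mergeWord, if_neg h]
      exact Or.inr ⟨hb, h⟩
  · rintro (rfl | ⟨ha, h⟩)
    · exact ⟨a ++ [0], hw 0, if_pos ⟨0, rfl⟩⟩
    · exact ⟨a, ha, if_neg h⟩

theorem IsCode.splitAt_merge {A : Finset Word} (hA : IsCode A) {w : Word}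
    (hw : ∀ x, w ++ [x] ∈ A) : splitAt w (A.image (mergeWord w)) = A := by
  ext a
  rw [mem_splitAt, mem_image_mergeWord hw, mem_image_mergeWord hw]
  constructor
  · rintro (⟨h | h, h'⟩ | ⟨-, x, rfl⟩)
    · exact (h' h).elim
    · exact h.1
    · exact hw x
  · intro ha
    by_cases h : ∃ x, a = w ++ [x]
    · exact Or.inr ⟨Or.inl rfl, h⟩
    · refine Or.inl ⟨Or.inr ⟨ha, h⟩, ?_⟩
      rintro rfl
      exact hA.notMem_of_children hw ha

theorem IsCode.card_merge_lt {A : Finset Word} {w : Word} (hw : ∀ x, w ++ [x] ∈ A) :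
    (A.image (mergeWord w)).card < A.card := by
  refine lt_of_le_of_ne Finset.card_image_le fun h => ?_
  have := Finset.card_image_iff.1 h (hw 0) (hw 1)
    ((if_pos ⟨0, rfl⟩).trans (if_pos ⟨1, rfl⟩).symm)
  simp at this

theorem IsCode.exists_longest {A : Finset Word} (hA : IsCode A) :
    ∃ a ∈ A, ∀ b ∈ A, b.length ≤ a.length := by
  obtain ⟨a, ha, -⟩ := hA.exists_mem fun _ => 0
  exact A.exists_max_image List.length ⟨a, ha⟩

/-- Complete prefix codes are obtained from the trivial one by successive subdivisions. -/
theorem IsCode.induction {motive : Finset Word → Prop} (trivial : motive {[]})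
    (split : ∀ A w, w ∈ A → motive A → motive (splitAt w A)) {A : Finset Word} (hA : IsCode A) :
    motive A := by
  induction hn : A.card using Nat.strong_induction_on generalizing A with
  | _ n ih =>
  obtain ⟨a, ha, hmax⟩ := hA.exists_longest
  rcases List.eq_nil_or_concat a with rfl | ⟨w, x, rfl⟩
  · have : A = {[]} := Finset.eq_singleton_iff_unique_mem.2
      ⟨ha, fun b hb => by simpa using hmax b hb⟩
    rwa [this]
  · rw [List.concat_eq_append] at ha hmax
    -- Merging a longest word with its sibling lowers the cardinality, and splitting undoes the
    -- merger.
    have hw := hA.sibling_mem ha (by simpa using hmax)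
    rw [← hA.splitAt_merge hw]
    exact split _ _ ((mem_image_mergeWord hw).2 (Or.inl rfl))
      (ih _ (hn ▸ IsCode.card_merge_lt hw) (hA.merge hw) rfl)

theorem vsubStrip_product (w : Word) (A B : Finset Word) :
    vsubStrip w (A ×ˢ B) = splitAt w A ×ˢ B := by
  ext ⟨a, b⟩
  simp only [vsubStrip, splitAt, Finset.mem_biUnion, Finset.mem_product, Prod.exists]
  constructor
  · rintro ⟨c, d, ⟨hc, hd⟩, h⟩
    split_ifs at h with hcw
    · subst hcw
      simp only [Rect.vhalf, Finset.mem_insert, Finset.mem_singleton, Prod.mk.injEq] at h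
      exact ⟨⟨c, hc, by simp; tauto⟩, by rcases h with h | h <;> rwa [h.2]⟩
    · simp only [Finset.mem_singleton, Prod.mk.injEq] at h
      exact ⟨⟨c, hc, by simp [hcw, h.1]⟩, h.2 ▸ hd⟩
  · rintro ⟨⟨c, hc, h⟩, hb⟩
    refine ⟨c, b, ⟨hc, hb⟩, ?_⟩
    split_ifs at h ⊢ with hcw
    · subst hcw
      simpa [Rect.vhalf] using h
    · simpa using h

theorem hsubStrip_product (w : Word) (A B : Finset Word) :
    hsubStrip w (A ×ˢ B) = A ×ˢ splitAt w B := by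
  ext ⟨a, b⟩
  simp only [hsubStrip, splitAt, Finset.mem_biUnion, Finset.mem_product, Prod.exists]
  constructor
  · rintro ⟨c, d, ⟨hc, hd⟩, h⟩
    split_ifs at h with hdw
    · subst hdw
      simp only [Rect.hhalf, Finset.mem_insert, Finset.mem_singleton, Prod.mk.injEq] at h
      exact ⟨by rcases h with h | h <;> rwa [h.1], ⟨d, hd, by simp; tauto⟩⟩
    · simp only [Finset.mem_singleton, Prod.mk.injEq] at h
      exact ⟨h.1 ▸ hc, ⟨d, hd, by simp [hdw, h.2]⟩⟩
  · rintro ⟨ha, ⟨d, hd, h⟩⟩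
    refine ⟨a, d, ⟨ha, hd⟩, ?_⟩
    split_ifs at h ⊢ with hdw
    · subst hdw
      simpa [Rect.hhalf] using h
    · simpa using h

theorem IsGridPattern.exists_product {G : Finset Rect} (hG : IsGridPattern G) :
    ∃ A B : Finset Word, G = A ×ˢ B := by
  induction hG with
  | trivial => exact ⟨{[]}, {[]}, rfl⟩
  | vert _ _ ih =>
    obtain ⟨A, B, rfl⟩ := ih
    exact ⟨_, _, vsubStrip_product _ _ _⟩
  | horiz _ _ ih =>
    obtain ⟨A, B, rfl⟩ := ih
    exact ⟨_, _, hsubStrip_product _ _ _⟩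

theorem IsCode.isGridPattern_product {A B : Finset Word} (hA : IsCode A) (hB : IsCode B) :
    IsGridPattern (A ×ˢ B) := by
  obtain ⟨b, hb, -⟩ := hB.exists_mem fun _ => 0
  refine hA.induction (motive := fun A => IsGridPattern (A ×ˢ B)) ?_ fun A w hw ih => ?_
  · refine hB.induction (motive := fun B => IsGridPattern ({[]} ×ˢ B)) .trivial
      fun B w hw ih => ?_
    rw [← hsubStrip_product]
    exact ih.horiz (R := ([], w)) (by simpa using hw)
  · rw [← vsubStrip_product]
    exact ih.vert (R := (w, b)) (Finset.mem_product.2 ⟨hw, hb⟩)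

/-- Restricting the tiling to a horizontal line through a fixed row gives `A`, and to a vertical
line through a fixed column gives `B`. -/
theorem isCode_of_isTiling_product {A B : Finset Word} (h : IsTiling Rect.toSet (A ×ˢ B)) :
    IsCode A ∧ IsCode B := by
  obtain ⟨⟨a, b⟩, hR, -⟩ := h.exists_mem (fun _ => 0, fun _ => 0)
  obtain ⟨ha, hb⟩ := Finset.mem_product.1 hR
  obtain ⟨ζ, hζ⟩ := cyl_nonempty a
  obtain ⟨η, hη⟩ := cyl_nonempty b
  refine ⟨isTiling_of (fun z => ?_) fun z c hc d hd hzc hzd => ?_,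
    isTiling_of (fun z => ?_) fun z c hc d hd hzc hzd => ?_⟩
  · obtain ⟨R, hR, hz⟩ := h.exists_mem (z, η)
    exact ⟨R.1, (Finset.mem_product.1 hR).1, (mem_toSet.1 hz).1⟩
  · exact congrArg Prod.fst (h.unique (c := (c, b)) (d := (d, b)) (Finset.mk_mem_product hc hb)
      (Finset.mk_mem_product hd hb) (z := (z, η)) (mem_toSet.2 ⟨hzc, hη⟩) (mem_toSet.2 ⟨hzd, hη⟩))
  · obtain ⟨R, hR, hz⟩ := h.exists_mem (ζ, z)
    exact ⟨R.2, (Finset.mem_product.1 hR).2, (mem_toSet.1 hz).2⟩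
  · exact congrArg Prod.snd (h.unique (c := (a, c)) (d := (a, d)) (Finset.mk_mem_product ha hc)
      (Finset.mk_mem_product ha hd) (z := (ζ, z)) (mem_toSet.2 ⟨hζ, hzc⟩) (mem_toSet.2 ⟨hζ, hzd⟩))


/-! ### Global reductions of grid diagrams -/

theorem PatternPair.isTiling_dom (p : PatternPair) :
    IsTiling (Rect.toSet ∘ Prod.fst) p.cells :=
  (isTiling_image toSet_nonempty).2 ⟨p.dom_inj, p.dom_isPattern.isTiling⟩

theorem PatternPair.isTiling_tgt (p : PatternPair) :
    IsTiling (Rect.toSet ∘ Prod.snd) p.cells :=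
  (isTiling_image toSet_nonempty).2 ⟨p.tgt_inj, p.tgt_isPattern.isTiling⟩

/-- The pair of patterns given by cells whose domain and target rectangles are tilings. -/
def PatternPair.ofTiling (C : Finset (Rect × Rect)) (h₁ : IsTiling (Rect.toSet ∘ Prod.fst) C)
    (h₂ : IsTiling (Rect.toSet ∘ Prod.snd) C) : PatternPair where
  cells := C
  dom_inj := ((isTiling_image toSet_nonempty).1 h₁).1
  tgt_inj := ((isTiling_image toSet_nonempty).1 h₂).1
  dom_isPattern := isPattern_iff_isTiling.2 ((isTiling_image toSet_nonempty).1 h₁).2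
  tgt_isPattern := isPattern_iff_isTiling.2 ((isTiling_image toSet_nonempty).1 h₂).2

/-- Merges the halves of the cells whose target lies in the vertical strip with address `w`. -/
def mergeCell (w : Word) (c : Rect × Rect) : Rect × Rect :=
  if ∃ x, c.2.1 = w ++ [x] then ((c.1.1.dropLast, c.1.2), (w, c.2.2)) else c

theorem mergeCell_append (u v w b : Word) (x : Fin 2) :
    mergeCell w ((u ++ [x], v), (w ++ [x], b)) = ((u, v), (w, b)) := by
  simp [mergeCell]

theorem mergeCell_of_not {w : Word} {c : Rect × Rect} (h : ¬ ∃ x, c.2.1 = w ++ [x]) :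
    mergeCell w c = c := if_neg h

/-- The cells over the two halves of the target strip with address `w` are siblings in pairs. -/
def StripReducible (w : Word) (C : Finset (Rect × Rect)) : Prop :=
  ∀ c ∈ C, ∀ x, c.2.1 = w ++ [x] → ∃ u v b, c = ((u ++ [x], v), (w ++ [x], b)) ∧
    ∀ y, ((u ++ [y], v), (w ++ [y], b)) ∈ C

theorem StripReducible.isTiling_dom {w : Word} {C : Finset (Rect × Rect)}
    (h : StripReducible w C) (hC : IsTiling (Rect.toSet ∘ Prod.fst) C) :
    IsTiling (Rect.toSet ∘ Prod.fst) (C.image (mergeCell w)) := by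
  refine hC.image_merge _ (fun c hc => ?_) fun c hc z hz => ?_ <;>
    by_cases hcw : ∃ x, c.2.1 = w ++ [x]
  · obtain ⟨x, hx⟩ := hcw
    obtain ⟨u, v, b, rfl, -⟩ := h c hc x hx
    rw [mergeCell_append]
    exact fun z hz => mem_toSet.2
      ⟨cyl_append_subset _ _ (mem_toSet.1 hz).1, (mem_toSet.1 hz).2⟩
  · rw [mergeCell_of_not hcw]
  · obtain ⟨x, hx⟩ := hcw
    obtain ⟨u, v, b, rfl, hy⟩ := h c hc x hx
    rw [mergeCell_append] at hz
    -- The letter after `u` tells which of the two sibling cells contains `z`.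
    obtain ⟨y, hzy⟩ := exists_mem_cyl_append (mem_toSet.1 hz).1
    exact ⟨_, hy y, by simp only [mergeCell_append], mem_toSet.2 ⟨hzy, (mem_toSet.1 hz).2⟩⟩
  · rw [mergeCell_of_not hcw] at hz
    exact ⟨c, hc, rfl, hz⟩

theorem StripReducible.isTiling_tgt {w : Word} {C : Finset (Rect × Rect)}
    (h : StripReducible w C) (hC : IsTiling (Rect.toSet ∘ Prod.snd) C) :
    IsTiling (Rect.toSet ∘ Prod.snd) (C.image (mergeCell w)) := by
  refine hC.image_merge _ (fun c hc => ?_) fun c hc z hz => ?_ <;>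
    by_cases hcw : ∃ x, c.2.1 = w ++ [x]
  · obtain ⟨x, hx⟩ := hcw
    obtain ⟨u, v, b, rfl, -⟩ := h c hc x hx
    rw [mergeCell_append]
    exact fun z hz => mem_toSet.2
      ⟨cyl_append_subset _ _ (mem_toSet.1 hz).1, (mem_toSet.1 hz).2⟩
  · rw [mergeCell_of_not hcw]
  · obtain ⟨x, hx⟩ := hcw
    obtain ⟨u, v, b, rfl, hy⟩ := h c hc x hx
    rw [mergeCell_append] at hz
    obtain ⟨y, hzy⟩ := exists_mem_cyl_append (mem_toSet.1 hz).1
    exact ⟨_, hy y, by simp only [mergeCell_append], mem_toSet.2 ⟨hzy, (mem_toSet.1 hz).2⟩⟩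
  · rw [mergeCell_of_not hcw] at hz
    exact ⟨c, hc, rfl, hz⟩

/-- Subdividing undoes the merger. The hypothesis `hw` ensures that the subdivided strip consists of
merged cells only. -/
theorem StripReducible.biUnion_eq {w : Word} {C : Finset (Rect × Rect)}
    (h : StripReducible w C) (hw : ∀ c ∈ C, c.2.1 ≠ w) :
    (C.image (mergeCell w)).biUnion (fun c => if c.2.1 = w then
      {(c.1.vhalf 0, c.2.vhalf 0), (c.1.vhalf 1, c.2.vhalf 1)} else {c}) = C := by
  have hhalf : ∀ u v b : Word, ∀ d : Rect × Rect,
      d ∈ ({(Rect.vhalf (u, v) 0, Rect.vhalf (w, b) 0),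
        (Rect.vhalf (u, v) 1, Rect.vhalf (w, b) 1)} : Finset (Rect × Rect)) ↔
      ∃ y, d = ((u ++ [y], v), (w ++ [y], b)) := by
    intro u v b d
    simp [Fin.exists_fin_two, Rect.vhalf]
  ext d
  rw [Finset.image_biUnion, Finset.mem_biUnion]
  constructor
  · rintro ⟨c, hc, hd⟩
    by_cases hcw : ∃ x, c.2.1 = w ++ [x]
    · obtain ⟨x, hx⟩ := hcw
      obtain ⟨u, v, b, rfl, hy⟩ := h c hc x hx
      rw [mergeCell_append, if_pos rfl, hhalf] at hd
      obtain ⟨y, rfl⟩ := hd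
      exact hy y
    · rw [mergeCell_of_not hcw, if_neg (hw c hc)] at hd
      rwa [Finset.mem_singleton.1 hd]
  · intro hd
    refine ⟨d, hd, ?_⟩
    by_cases hdw : ∃ x, d.2.1 = w ++ [x]
    · obtain ⟨x, hx⟩ := hdw
      obtain ⟨u, v, b, rfl, -⟩ := h d hd x hx
      rw [mergeCell_append, if_pos rfl, hhalf]
      exact ⟨x, rfl⟩
    · rw [mergeCell_of_not hdw, if_neg (hw d hd)]
      exact Finset.mem_singleton_self d

/-- The product form of the target makes the sibling of a target rectangle the target of another
cell. By `LocallyFine.exists_sibling` and the uniqueness of the source rectangle, the domain of that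
cell is the sibling of the original domain. -/
theorem LocallyFine.stripReducible {g : Homeo} {n : ℕ} (hg : LocallyFine g n) {q : PatternPair}
    (hqg : q.Represents g) {A B : Finset Word} (hAB : q.tgt = A ×ˢ B) {w : Word}
    (hw : ∀ x, w ++ [x] ∈ A) (hl : n ≤ w.length) : StripReducible w q.cells := by
  intro c hc x hx
  obtain ⟨u, hu, hy⟩ := hg.exists_sibling (hqg c hc) hx hl
  refine ⟨u, c.1.2, c.2.2, Prod.ext (Prod.ext hu rfl) (Prod.ext hx rfl), fun y => ?_⟩
  have hcB : c.2.2 ∈ B := by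
    have : c.2 ∈ q.tgt := Finset.mem_image_of_mem _ hc
    rw [hAB] at this
    exact (Finset.mem_product.1 this).2
  have hmem : (w ++ [y], c.2.2) ∈ q.tgt := hAB ▸ Finset.mk_mem_product (hw y) hcB
  obtain ⟨e, he, he2⟩ := Finset.mem_image.1 hmem
  have he1 : e.1 = (u ++ [y], c.1.2) := (hqg e he).dom_unique (he2 ▸ hy y)
  rwa [← he1, ← he2]

theorem image_snd_mergeCell {w : Word} {C : Finset (Rect × Rect)} {A B : Finset Word}
    (h : C.image Prod.snd = A ×ˢ B) :
    (C.image (mergeCell w)).image Prod.snd = A.image (mergeWord w) ×ˢ B := by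
  have h1 : Prod.snd ∘ mergeCell w = Prod.map (mergeWord w) id ∘ Prod.snd := by
    funext c
    simp only [Function.comp, mergeCell, mergeWord, Prod.map]
    split_ifs <;> rfl
  rw [Finset.image_image, h1, ← Finset.image_image, h]
  ext ⟨a, b⟩
  simp only [Finset.mem_image, Finset.mem_product, Prod.map, Prod.exists, Prod.mk.injEq, id]
  constructor
  · rintro ⟨c, d, ⟨hc, hd⟩, rfl, rfl⟩
    exact ⟨⟨c, hc, rfl⟩, hd⟩
  · rintro ⟨⟨c, hc, rfl⟩, hb⟩
    exact ⟨c, b, ⟨hc, hb⟩, rfl, rfl⟩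

/-- The strip of `R` itself may have a sibling interval that is further subdivided. A longest word
of `A` is merged instead: it is also longer than `n`, and its sibling is in `A`. -/
theorem LocallyFine.exists_vertGlobalSub {g : Homeo} {n : ℕ} (hg : LocallyFine g n)
    {q : PatternPair} (hq : q.IsGridDiagram) (hqg : q.Represents g) {R : Rect} (hR : R ∈ q.tgt)
    (hn : n < R.1.length) : ∃ p : PatternPair, p.IsGridDiagram ∧ p.VertGlobalSub q := by
  obtain ⟨A, B, hAB⟩ := IsGridPattern.exists_product hq
  have htile : IsTiling Rect.toSet (A ×ˢ B) := hAB ▸ q.tgt_isPattern.isTiling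
  obtain ⟨hA, hB⟩ := isCode_of_isTiling_product htile
  obtain ⟨a, ha, hmax⟩ := hA.exists_longest
  obtain ⟨hRA, hRB⟩ := Finset.mem_product.1 (hAB ▸ hR)
  obtain ⟨w, x, rfl, hl⟩ := exists_eq_append_of_length_lt (hn.trans_le (hmax _ hRA))
  have hw := hA.sibling_mem ha (by simpa using hmax)
  have hred := hg.stripReducible hqg hAB hw hl
  let p := PatternPair.ofTiling _ (hred.isTiling_dom q.isTiling_dom)
    (hred.isTiling_tgt q.isTiling_tgt)
  have hp : p.tgt = A.image (mergeWord w) ×ˢ B := image_snd_mergeCell hAB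
  refine ⟨p, ?_, (w, R.2), ?_, (hred.biUnion_eq fun c hc hcw => ?_).symm⟩
  · rw [PatternPair.IsGridDiagram, hp]
    exact (hA.merge hw).isGridPattern_product hB
  · rw [hp]
    exact Finset.mk_mem_product ((mem_image_mergeWord hw).2 (Or.inl rfl)) hRB
  · have : c.2 ∈ A ×ˢ B := hAB ▸ Finset.mem_image_of_mem _ hc
    exact hA.notMem_of_children hw (hcw ▸ (Finset.mem_product.1 this).1)

/-! ### Interchanging the coordinates of a pair of patterns -/

theorem IsPattern.swap {P : Finset Rect} (h : IsPattern P) : IsPattern (P.image Prod.swap) := by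
  rw [isPattern_iff_isTiling] at h ⊢
  have h' : IsTiling (Rect.toSet ∘ Prod.swap) P := by
    refine isTiling_of (fun z => ?_) fun z c hc d hd hzc hzd => ?_
    · obtain ⟨R, hR, hz⟩ := h.exists_mem z.swap
      exact ⟨R, hR, mem_toSet.2 (mem_toSet.1 hz).symm⟩
    · exact h.unique (z := z.swap) hc hd (mem_toSet.2 (mem_toSet.1 hzc).symm)
        (mem_toSet.2 (mem_toSet.1 hzd).symm)
  exact ((isTiling_image toSet_nonempty).1 h').2

/-- Interchanges the coordinates of the domain and target rectangles of a cell. -/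
def swapCell (c : Rect × Rect) : Rect × Rect := (c.1.swap, c.2.swap)

theorem swapCell_swapCell (c : Rect × Rect) : swapCell (swapCell c) = c := rfl

theorem swapCell_injective : Function.Injective swapCell :=
  Function.LeftInverse.injective swapCell_swapCell

theorem image_fst_swapCell (C : Finset (Rect × Rect)) :
    (C.image swapCell).image Prod.fst = (C.image Prod.fst).image Prod.swap := by
  simp only [Finset.image_image]; rfl

theorem image_snd_swapCell (C : Finset (Rect × Rect)) :
    (C.image swapCell).image Prod.snd = (C.image Prod.snd).image Prod.swap := by
  simp only [Finset.image_image]; rfl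

/-- Interchanges the two coordinates in a pair of patterns. -/
def PatternPair.swap (p : PatternPair) : PatternPair where
  cells := p.cells.image swapCell
  dom_inj := by
    intro c hc d hd h
    obtain ⟨c, hc', rfl⟩ := Finset.mem_image.1 (Finset.mem_coe.1 hc)
    obtain ⟨d, hd', rfl⟩ := Finset.mem_image.1 (Finset.mem_coe.1 hd)
    rw [p.dom_inj hc' hd' (Prod.swap_injective h)]
  tgt_inj := by
    intro c hc d hd h
    obtain ⟨c, hc', rfl⟩ := Finset.mem_image.1 (Finset.mem_coe.1 hc)
    obtain ⟨d, hd', rfl⟩ := Finset.mem_image.1 (Finset.mem_coe.1 hd)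
    rw [p.tgt_inj hc' hd' (Prod.swap_injective h)]
  dom_isPattern := by
    rw [image_fst_swapCell]
    exact p.dom_isPattern.swap
  tgt_isPattern := by
    rw [image_snd_swapCell]
    exact p.tgt_isPattern.swap

theorem PatternPair.swap_tgt (p : PatternPair) : p.swap.tgt = p.tgt.image Prod.swap :=
  image_snd_swapCell _

theorem PatternPair.Represents.swap {p : PatternPair} {g : Homeo} (h : p.Represents g) :
    p.swap.Represents (swapHomeo g) := by
  intro c hc
  obtain ⟨d, hd, rfl⟩ := Finset.mem_image.1 hc
  exact (h d hd).swap

theorem PatternPair.IsGridDiagram.swap {p : PatternPair} (h : p.IsGridDiagram) :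
    p.swap.IsGridDiagram := by
  obtain ⟨A, B, hAB⟩ := IsGridPattern.exists_product h
  have htile : IsTiling Rect.toSet (A ×ˢ B) := hAB ▸ p.tgt_isPattern.isTiling
  obtain ⟨hA, hB⟩ := isCode_of_isTiling_product htile
  rw [PatternPair.IsGridDiagram, PatternPair.swap_tgt, hAB, Finset.image_swap_product]
  exact hB.isGridPattern_product hA

theorem PatternPair.VertGlobalSub.swap {p q : PatternPair} (h : p.VertGlobalSub q.swap) :
    p.swap.HorizGlobalSub q := by
  obtain ⟨R, hR, h⟩ := h
  refine ⟨R.swap, ?_, ?_⟩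
  · rw [PatternPair.swap_tgt]
    exact Finset.mem_image_of_mem _ hR
  -- The two sets of cells are compared after exchanging coordinates, which turns the horizontal
  -- subdivision into the given vertical one.
  · apply Finset.image_injective swapCell_injective
    refine Eq.trans h ?_
    change _ = ((p.cells.image swapCell).biUnion _).image swapCell
    rw [Finset.image_biUnion, Finset.biUnion_image]
    refine Finset.biUnion_congr rfl fun c _ => ?_
    change _ = Finset.image swapCell (if c.2.1 = R.1 then _ else _)
    split_ifs
    · rw [Finset.image_insert, Finset.image_singleton]
      rfl
    · rw [Finset.image_singleton]
      rfl

theorem LocallyFine.exists_horizGlobalSub {g : Homeo} {n : ℕ} (hg : LocallyFine g n)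
    {q : PatternPair} (hq : q.IsGridDiagram) (hqg : q.Represents g) {R : Rect} (hR : R ∈ q.tgt)
    (hn : n < R.2.length) : ∃ p : PatternPair, p.IsGridDiagram ∧ p.HorizGlobalSub q := by
  have hR' : R.swap ∈ q.swap.tgt := by
    rw [PatternPair.swap_tgt]
    exact Finset.mem_image_of_mem _ hR
  obtain ⟨p, hp, hpq⟩ := hg.swap.exists_vertGlobalSub hq.swap hqg.swap hR' hn
  exact ⟨p.swap, hp.swap, hpq.swap⟩

/-! ### Bounds on fineness and on essential rectangles. -/

theorem LocallyFine.le_of_hasFineness {g : Homeo} {n k : ℕ} (hg : LocallyFine g n)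
    (hk : HasFineness g k) : k ≤ 2 * n := by
  obtain ⟨q, ⟨hq, hv, hh⟩, hqg, rfl⟩ := hk
  refine Finset.sup_le fun R hR => ?_
  have h1 : ¬ n < R.1.length := fun h => hv (hg.exists_vertGlobalSub hq hqg hR h)
  have h2 : ¬ n < R.2.length := fun h => hh (hg.exists_horizGlobalSub hq hqg hR h)
  rw [Rect.size]
  omega

theorem LocallyFine.size_le_of_isEssential {g : Homeo} {n : ℕ} (hg : LocallyFine g n)
    {D R : Rect} (hDR : MapsRect g D R) (hR : IsEssential g R) : R.size ≤ 2 * n := by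
  have h1 : ¬ n < R.1.length := fun h => hR.1 (hg.vertReducible hDR h)
  have h2 : ¬ n < R.2.length := fun h => hR.2 (hg.horizReducible hDR h)
  rw [Rect.size]
  omega

end TwoV

theorem mainTheorem3 (X : Set TwoV.Homeo) (hX : X = TwoV.X2V ∨ X ⊆ TwoV.depthAtMost 4)
    (g : TwoV.Homeo) (hg : g ∈ TwoV.twoV) :
    (∀ k : ℕ, TwoV.HasFineness g k → (k : ℕ∞) ≤ 8 * TwoV.wordLength X g) ∧
    (∀ p : TwoV.PatternPair, p.Represents g → ∀ R ∈ p.tgt, TwoV.IsEssential g R →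
      (R.size : ℕ∞) ≤ 8 * TwoV.wordLength X g) := by
  have hfine : ∀ s ∈ X, TwoV.LocallyFine s 4 ∧ TwoV.LocallyFine s.symm 4 := by
    rcases hX with rfl | hX
    · exact fun s hs => TwoV.locallyFine_of_mem_X2V hs
    · exact fun s hs => TwoV.locallyFine_of_mem_depthAtMost (hX hs)
  have hword : ∀ l : List TwoV.Homeo, (∀ s ∈ l, s ∈ X ∨ s.symm ∈ X) → TwoV.evalWord l = g →
      TwoV.LocallyFine g (4 * l.length) := by
    rintro l hl rfl
    refine TwoV.locallyFine_evalWord fun s hs => ?_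
    rcases hl s hs with h | h
    · exact (hfine s h).1
    · exact (hfine _ h).2
  constructor
  · intro k hk
    -- The constant is `8 = 2 · 4`: two coordinates, each growing by at most 4 per letter.
    refine TwoV.le_mul_wordLength (d := 8) (fun l hl h => ?_) (by norm_num)
    have := (hword l hl h).le_of_hasFineness hk
    omega
  · intro p hp R hR hess
    refine TwoV.le_mul_wordLength (d := 8) (fun l hl h => ?_) (by norm_num)
    obtain ⟨c, hc, rfl⟩ := Finset.mem_image.1 hR
    have := (hword l hl h).size_le_of_isEssential (hp c hc) hess
    omega
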